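/- Call an even real-valued function $g\in C^3(\mathbb R)$ an admissible kernel with constants $C_0,C_1,C_2,C_3,\varepsilon,\beta>0$ if $|g^{(\ell)}(t)|\le C_\ell/(1+t^2)$ for all $t\in\mathbb R$ and $\ell=0,1,2,3$; $g(t)>0$ for $|t|\le\varepsilon$; $g(t)<g(\varepsilon)$ for $|t|>\varepsilon$; and $g^{(2)}(t)<-\beta$ for $|t|\le\varepsilon$. For every admissible kernel $g$ there is $\nu_0>0$, depending only on $g$ and these constants, such that for every $\nu\ge\nu_0$ and all real $N,\sigma>0$ the following holds. Put $g_\sigma[k]:=g\big(k/(\sigma N)\big)$ for $k\in\mathbb Z$. Let $x=\sum_m c_m\delta[\cdot-k_m]\in\ell_1(\mathbb Z)$ be real, with distinct $k_m$ and all $c_m\neq0$, and let its support $K=\{k_m\}\subset\mathbb Z$ satisfy $|k_i-k_j|\ge\nu\sigma N$ for all distinct $k_i,k_j\in K$. Let $y=g_\sigma*x+n$ with $\|n\|_1\le\delta$, and let $\hat x=\sum_m\hat c_m\delta[\cdot-\hat k_m]$, with support $\hat K=\{\hat k_m\}$, be any solution of $$\min_{\tilde x}\|\tilde x\|_1\quad\text{subject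 to}\quad\|y-g_\sigma*\tilde x\|_1\le\delta .$$ Then $$\|\hat x-x\|_1\le\frac{16\gamma^2}{\beta}\,\delta,\qquad \gamma:=\max\{N\sigma,\varepsilon^{-1}\}.$$ Suppose in addition that $\varepsilon\ge\tilde\varepsilon:=\sqrt{g(0)/(C_2+\beta/4)}$. Put $$D_1:=\frac{\beta}{4g(0)},\qquad D_2:=\frac{3\nu^2\left(3|g^{(2)}(0)|\nu^2-\pi^2C_2\right)+\frac{16C_1^2\gamma^2\pi^2}{\beta}\left(1+\frac{\pi^2}{6\nu^2}\right)}{\left(3|g^{(2)}(0)|\nu^2-\pi^2C_2\right)\left(3g(0)\nu^2-2\pi^2C_0\right)},$$ $$T(e):=2\delta D_2\left(1+\max\left\{\frac1{D_1e^2},\frac{4C_2}{(N\sigma)^2\beta}\right\}\right).$$ Then: 1. For every $k_m\in K$ with $|c_m|\ge T(\varepsilon)$ there is $\hat k\in\hat K$ such that $$|k_m-\hat k|\le N\sigma\sqrt{\frac{2D_2\delta}{D_1\left(|c_m|-T(\tilde\varepsilon)\right)}},$$ where the right-hand side is read as $+\infty$ if $|c_m|\le T(\tilde\varepsilon)$.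 2. $$\sum_{\hat k_m\in\hat K:\ |\hat k_m-k_n|>N\varepsilon\sigma\ \forall k_n\in K}|\hat c_m|\le\frac{2D_2}{D_1\varepsilon^2}\,\delta .$$ -/

import Mathlib

open scoped ENNReal

namespace StreamOfPulses

noncomputable section

/-- `g` is an admissible kernel with global constants `C 0, C 1, C 2, C 3` and local constants
`ε`, `β`. -/
structure IsAdmissibleKernel (g : ℝ → ℝ) (C : Fin 4 → ℝ) (ε β : ℝ) : Prop where
  contDiff : ContDiff ℝ 3 g
  even : ∀ t : ℝ, g (-t) = g t
  const_pos : ∀ l : Fin 4, 0 < C l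
  global_bound : ∀ (l : Fin 4) (t : ℝ), |iteratedDeriv (l : ℕ) g t| ≤ C l / (1 + t ^ 2)
  eps_pos : 0 < ε
  beta_pos : 0 < β
  pos_near : ∀ t : ℝ, |t| ≤ ε → 0 < g t
  lt_far : ∀ t : ℝ, ε < |t| → g t < g ε
  concave_near : ∀ t : ℝ, |t| ≤ ε → iteratedDeriv 2 g t < -β

/-- The sampled and dilated kernel `g_σ[k] = g[k / σ]`, where `g[k] = g (k / N)`. -/
def sampledKernel (g : ℝ → ℝ) (N σ : ℝ) (k : ℤ) : ℝ := g ((k : ℝ) / σ / N)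

/-- Discrete convolution of two sequences on `ℤ`. -/
def conv (a b : ℤ → ℝ) (k : ℤ) : ℝ := ∑' j : ℤ, a (k - j) * b j

/-- The `ℓ¹` norm of a real sequence on `ℤ`, equal to `∞` if the sequence is not summable. -/
def l1Norm (f : ℤ → ℝ) : ℝ≥0∞ := ∑' k : ℤ, ‖f k‖ₑ

/-- The minimal separation condition, with separation constant `ν`. -/
def SatisfiesSeparation (K : Set ℤ) (ν N σ : ℝ) : Prop :=
  ∀ k ∈ K, ∀ j ∈ K, k ≠ j → ν * σ * N ≤ |(k : ℝ) - (j : ℝ)|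

/-- `z` is feasible: `‖y - a * z‖₁ ≤ δ`. -/
def IsFeasible (a y : ℤ → ℝ) (δ : ℝ) (z : ℤ → ℝ) : Prop :=
  l1Norm (fun k => y k - conv a z k) ≤ ENNReal.ofReal δ

/-- `z` solves: minimize `‖z‖₁` subject to `‖y - a * z‖₁ ≤ δ`. -/
def IsSolution (a y : ℤ → ℝ) (δ : ℝ) (z : ℤ → ℝ) : Prop :=
  IsFeasible a y δ z ∧ ∀ w : ℤ → ℝ, IsFeasible a y δ w → l1Norm z ≤ l1Norm w

/-- `γ = max {N σ, ε⁻¹}`. -/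
def gam (N σ ε : ℝ) : ℝ := max (N * σ) ε⁻¹

/-- The threshold `√(g(0) / (C₂ + β / 4))`. -/
def epsTilde (g : ℝ → ℝ) (C : Fin 4 → ℝ) (β : ℝ) : ℝ := Real.sqrt (g 0 / (C 2 + β / 4))

/-- `D₁ = β / (4 g(0))`. -/
def D1 (g : ℝ → ℝ) (β : ℝ) : ℝ := β / (4 * g 0)

/-- The constant `D₂`. -/
def D2 (g : ℝ → ℝ) (C : Fin 4 → ℝ) (ε β ν N σ : ℝ) : ℝ :=
  (3 * ν ^ 2 * (3 * |iteratedDeriv 2 g 0| * ν ^ 2 - Real.pi ^ 2 * C 2)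
      + 16 * C 1 ^ 2 * gam N σ ε ^ 2 * Real.pi ^ 2 / β * (1 + Real.pi ^ 2 / (6 * ν ^ 2)))
    / ((3 * |iteratedDeriv 2 g 0| * ν ^ 2 - Real.pi ^ 2 * C 2)
      * (3 * g 0 * ν ^ 2 - 2 * Real.pi ^ 2 * C 0))

/-- The amplitude level `2 δ D₂ (1 + max {1 / (D₁ e²), 4 C₂ / ((N σ)² β)})`; it is used with
`e = ε` and with `e = epsTilde`. -/
def level (g : ℝ → ℝ) (C : Fin 4 → ℝ) (ε β ν N σ δ e : ℝ) : ℝ :=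
  2 * δ * D2 g C ε β ν N σ
    * (1 + max (1 / (D1 g β * e ^ 2)) (4 * C 2 / ((N * σ) ^ 2 * β)))

end

end StreamOfPulses

/-!
Write `ω = N σ`, let `h` be the error of the solution and `K` the support of `x`. Feasibility gives
`‖g_σ * h‖₁ ≤ 2 δ`, and minimality says that the mass of `h` off `K` is at most its mass on `K`.
Hence every sequence `f` bounded by `1` whose convolution `q` with the kernel interpolates `L` times
the signs of `h` on `K`, with `|q| < L` off `K`, controls `∑ (L - |q|) |h|` off `K` by `2 δ`
(`tsum_gapMass_le`). When the gap `L - |q|` is at least `β / 4` times the squared scaled distance to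
`K`, capped at `ε²`, this yields both the `ℓ¹` error and the bound on the mass far from `K`
(`mul_tsum_abs_sub_le`). For the localization, the half sum of two such `q` equals `L` at one point
of `K` and vanishes to second order at all others (`amplitude_le_of_isolated`).

Such dual certificates exist when `K` is well separated (`exists_certificate`). Three difficulties
shape the construction.

* The kernel is not bounded below by `-g 0`, so a single translate of `g` need not be dominated by
  its value at the centre. If `g` is very negative at some sample, half of the two translates to the
  most negative sample is subtracted. This leaves the supremum norm of `f` unchanged and makes the
  pulse dominated by its central value (`exists_symPulse`); it costs a factor two in the gap, which
  is the factor between `β / 2` from Taylor's formula and the `β / 4` that is needed.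
* The samples form a lattice, so `g'` is not available as a convolution with `g_σ`. Where the
  sampling is fine, the odd pulse `g (· - τ) - g (· + τ)`, with `τ` a multiple of `1 / ω` of size
  about `ε`, takes its place; where it is coarse, neighbouring samples are far apart and no
  correction of the derivative is needed (`exists_oddPulse`).
* The coefficients solve an infinite linear system, which is a contraction because the interactions
  of distinct points of `K` add up to `O(ν⁻²)` by the quadratic decay (`tsum_weight_le`,
  `exists_interpolation`).

The strict inequality `g'' < -β` on a compact interval leaves a margin `β' > β` that absorbs all
`O(ν⁻²)` losses; this is why `ν₀` depends on `g` itself.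
-/

namespace StreamOfPulses

/-! ### Quadratic decay and second order expansions -/

lemma decay_shift {φ : ℝ → ℝ} {B : ℝ} (hφ : ∀ t, |φ t| ≤ B / (1 + t ^ 2)) (t s : ℝ) :
    |φ (t + s)| ≤ 2 * (1 + s ^ 2) * B / (1 + t ^ 2) := by
  have hB : 0 ≤ B := by
    have := (abs_nonneg _).trans (hφ 0)
    simpa using this
  refine (hφ (t + s)).trans ?_
  rw [div_le_div_iff₀ (by positivity) (by positivity)]
  nlinarith [mul_nonneg hB (sq_nonneg (t + 2 * s)), mul_nonneg hB (sq_nonneg (s * (t + s))),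
    mul_nonneg hB (sq_nonneg s)]

/-- `φ` is twice differentiable with derivatives `φ₁`, `φ₂`, and all three functions are bounded
by `B / (1 + t ^ 2)`. -/
structure Pulse (φ φ₁ φ₂ : ℝ → ℝ) (B : ℝ) : Prop where
  deriv₁ : ∀ t, HasDerivAt φ (φ₁ t) t
  deriv₂ : ∀ t, HasDerivAt φ₁ (φ₂ t) t
  bound₀ : ∀ t, |φ t| ≤ B / (1 + t ^ 2)
  bound₁ : ∀ t, |φ₁ t| ≤ B / (1 + t ^ 2)
  bound₂ : ∀ t, |φ₂ t| ≤ B / (1 + t ^ 2)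

namespace Pulse

variable {φ φ₁ φ₂ ψ ψ₁ ψ₂ : ℝ → ℝ} {B B' : ℝ}

lemma nonneg (h : Pulse φ φ₁ φ₂ B) : 0 ≤ B := by
  simpa using (abs_nonneg _).trans (h.bound₀ 0)

lemma le_bound (h : Pulse φ φ₁ φ₂ B) (t : ℝ) : |φ t| ≤ B :=
  (h.bound₀ t).trans (div_le_self h.nonneg (by nlinarith [sq_nonneg t]))

lemma mono (h : Pulse φ φ₁ φ₂ B) (hB : B ≤ B') : Pulse φ φ₁ φ₂ B' where
  deriv₁ := h.deriv₁
  deriv₂ := h.deriv₂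
  bound₀ t := (h.bound₀ t).trans (by gcongr)
  bound₁ t := (h.bound₁ t).trans (by gcongr)
  bound₂ t := (h.bound₂ t).trans (by gcongr)

lemma shift (h : Pulse φ φ₁ φ₂ B) (s : ℝ) :
    Pulse (fun t => φ (t + s)) (fun t => φ₁ (t + s)) (fun t => φ₂ (t + s))
      (2 * (1 + s ^ 2) * B) where
  deriv₁ t := (h.deriv₁ (t + s)).comp_add_const t s
  deriv₂ t := (h.deriv₂ (t + s)).comp_add_const t s
  bound₀ t := decay_shift h.bound₀ t s
  bound₁ t := decay_shift h.bound₁ t s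
  bound₂ t := decay_shift h.bound₂ t s

lemma add (h : Pulse φ φ₁ φ₂ B) (h' : Pulse ψ ψ₁ ψ₂ B') :
    Pulse (fun t => φ t + ψ t) (fun t => φ₁ t + ψ₁ t) (fun t => φ₂ t + ψ₂ t) (B + B') where
  deriv₁ t := (h.deriv₁ t).add (h'.deriv₁ t)
  deriv₂ t := (h.deriv₂ t).add (h'.deriv₂ t)
  bound₀ t := (abs_add_le _ _).trans (by rw [add_div]; exact add_le_add (h.bound₀ t) (h'.bound₀ t))
  bound₁ t := (abs_add_le _ _).trans (by rw [add_div]; exact add_le_add (h.bound₁ t) (h'.bound₁ t))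
  bound₂ t := (abs_add_le _ _).trans (by rw [add_div]; exact add_le_add (h.bound₂ t) (h'.bound₂ t))

lemma const_mul (h : Pulse φ φ₁ φ₂ B) (c : ℝ) :
    Pulse (fun t => c * φ t) (fun t => c * φ₁ t) (fun t => c * φ₂ t) (|c| * B) where
  deriv₁ t := (h.deriv₁ t).const_mul c
  deriv₂ t := (h.deriv₂ t).const_mul c
  bound₀ t := by rw [abs_mul, mul_div_assoc]; exact mul_le_mul_of_nonneg_left (h.bound₀ t) (abs_nonneg c)
  bound₁ t := by rw [abs_mul, mul_div_assoc]; exact mul_le_mul_of_nonneg_left (h.bound₁ t) (abs_nonneg c)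
  bound₂ t := by rw [abs_mul, mul_div_assoc]; exact mul_le_mul_of_nonneg_left (h.bound₂ t) (abs_nonneg c)

end Pulse

lemma abs_sub_linear_le {φ φ₁ φ₂ : ℝ → ℝ} (h₁ : ∀ t, HasDerivAt φ (φ₁ t) t)
    (h₂ : ∀ t, HasDerivAt φ₁ (φ₂ t) t) {y x M : ℝ}
    (hM : ∀ s, |s| ≤ |x| → |φ₂ (y + s)| ≤ M) :
    |φ (y + x) - φ y - φ₁ y * x| ≤ M * x ^ 2 := by
  have hM0 : 0 ≤ M := (abs_nonneg _).trans (hM 0 (by simp))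
  have hc : Convex ℝ (Set.Icc (y - |x|) (y + |x|)) := convex_Icc _ _
  have hy : y ∈ Set.Icc (y - |x|) (y + |x|) := by
    constructor <;> linarith [abs_nonneg x]
  have hyx : y + x ∈ Set.Icc (y - |x|) (y + |x|) := by
    constructor <;> linarith [neg_abs_le x, le_abs_self x]
  have hd : ∀ z ∈ Set.Icc (y - |x|) (y + |x|), ‖φ₁ z - φ₁ y‖ ≤ M * |x| := by
    intro z hz
    have hzx : |z - y| ≤ |x| := abs_le.2 ⟨by linarith [hz.1], by linarith [hz.2]⟩
    have := hc.norm_image_sub_le_of_norm_hasDerivWithin_le (f := φ₁) (f' := φ₂) (C := M)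
      (fun u _ => (h₂ u).hasDerivWithinAt)
      (fun u hu => by
        have := hM (u - y) (abs_le.2 ⟨by linarith [hu.1], by linarith [hu.2]⟩)
        simpa using this) hy hz
    exact this.trans (mul_le_mul_of_nonneg_left hzx hM0)
  have := hc.norm_image_sub_le_of_norm_hasDerivWithin_le (f := fun z => φ z - φ₁ y * z)
    (f' := fun z => φ₁ z - φ₁ y) (C := M * |x|)
    (fun u _ => by
      have := (h₁ u).sub ((hasDerivAt_id u).const_mul (φ₁ y))
      rw [mul_one] at this
      exact this.hasDerivWithinAt) hd hy hyx
  simp only [Real.norm_eq_abs, add_sub_cancel_left] at this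
  calc _ = |φ (y + x) - φ₁ y * (y + x) - (φ y - φ₁ y * y)| := by congr 1; ring
    _ ≤ M * |x| * |x| := this
    _ = M * x ^ 2 := by rw [mul_assoc, abs_mul_abs_self, sq]

lemma Pulse.abs_sub_linear_le {φ φ₁ φ₂ : ℝ → ℝ} {B : ℝ} (h : Pulse φ φ₁ φ₂ B) {ε x : ℝ}
    (hx : |x| ≤ ε) (y : ℝ) :
    |φ (y + x) - φ y - φ₁ y * x| ≤ 2 * (1 + ε ^ 2) * B / (1 + y ^ 2) * x ^ 2 := by
  refine StreamOfPulses.abs_sub_linear_le h.deriv₁ h.deriv₂ fun s hs => ?_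
  have hB := h.nonneg
  have : s ^ 2 ≤ ε ^ 2 := sq_le_sq' (by linarith [abs_le.1 (hs.trans hx)])
    (by linarith [abs_le.1 (hs.trans hx)])
  exact (decay_shift h.bound₂ y s).trans (by gcongr)

/-! ### Sums over the integers and over separated sets -/

lemma summable_decay {ω : ℝ} (hω : 0 < ω) (k : ℤ) :
    Summable fun j : ℤ => 1 / (1 + (((k : ℝ) - j) / ω) ^ 2) := by
  have h1 : Summable fun j : ℤ => 1 / ((j : ℝ) ^ 2) :=
    Real.summable_one_div_int_pow.2 one_lt_two
  have h2 := (Equiv.subLeft k).summable_iff.2 (h1.mul_left (ω ^ 2))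
  have h3 : Summable fun j : ℤ => if j = k then (1 : ℝ) else 0 :=
    (hasSum_ite_eq k (1 : ℝ)).summable
  refine (h2.add h3).of_nonneg_of_le (fun j => by positivity) fun j => ?_
  by_cases hj : j = k
  · subst hj; simp
  · have : ((k : ℝ) - j) ≠ 0 := sub_ne_zero.2 (by exact_mod_cast Ne.symm hj)
    have h4 : 0 < ((k : ℝ) - j) ^ 2 := by positivity
    simp only [Function.comp, Equiv.subLeft_apply, hj, if_false, add_zero]
    push_cast
    rw [mul_one_div, div_le_div_iff₀ (by positivity) h4]
    have : (1 + (((k : ℝ) - j) / ω) ^ 2) * ω ^ 2 = ω ^ 2 + ((k : ℝ) - j) ^ 2 := by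
      field_simp
    nlinarith [sq_nonneg ω]

lemma summable_mul_decay {ω : ℝ} (hω : 0 < ω) {φ : ℝ → ℝ} {B : ℝ}
    (hφ : ∀ t, |φ t| ≤ B / (1 + t ^ 2)) {α : ℤ → ℝ} {U : ℝ} (hα : ∀ j, |α j| ≤ U) (k : ℤ) :
    Summable fun j : ℤ => α j * φ (((k : ℝ) - j) / ω) := by
  refine Summable.of_norm_bounded ((summable_decay hω k).mul_left (U * B)) fun j => ?_
  rw [norm_mul, mul_one_div, mul_div_assoc]
  exact mul_le_mul (hα j) (hφ _) (norm_nonneg _) ((abs_nonneg _).trans (hα j))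

/-- The interaction weight of two distinct points of `K` at sampling scale `ω`. -/
noncomputable def weight (K : Set ℤ) (ω : ℝ) (i j : ℤ) : ℝ :=
  open Classical in
  if i ∈ K ∧ j ∈ K ∧ j ≠ i then 1 / (1 + (((i : ℝ) - j) / ω) ^ 2) else 0

lemma weight_nonneg (K : Set ℤ) (ω : ℝ) (i j : ℤ) : 0 ≤ weight K ω i j := by
  unfold weight; split_ifs <;> positivity

lemma weight_summable (K : Set ℤ) {ω : ℝ} (hω : 0 < ω) (i : ℤ) : Summable (weight K ω i) := by
  refine (summable_decay hω i).of_nonneg_of_le (weight_nonneg K ω i) fun j => ?_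
  unfold weight; split_ifs <;> first | exact le_rfl | positivity

/-- Sorting the points of a `ν`-separated set into the cells `[nν, (n+1)ν)` puts at most one point
in each cell, so the interactions of a point with all others add up to `O(ν⁻²)`. -/
lemma tsum_weight_le {K : Set ℤ} {ω ν : ℝ} (hω : 0 < ω) (hν : 0 < ν)
    (hK : ∀ k ∈ K, ∀ j ∈ K, k ≠ j → ν * ω ≤ |(k : ℝ) - j|) (i : ℤ) :
    ∑' j, weight K ω i j ≤ 8 / ν ^ 2 * ∑' n : ℤ, 1 / (1 + (n : ℝ) ^ 2) := by
  classical
  have hZ : Summable fun n : ℤ => 1 / (1 + (n : ℝ) ^ 2) := by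
    have := summable_decay one_pos 0
    simpa using this
  rw [← tsum_mul_left]
  by_cases hi : i ∈ K
  swap
  · have : weight K ω i = 0 := by
      funext j; simp [weight, hi]
    rw [this]
    simpa using tsum_nonneg (fun n : ℤ => by positivity)
  have hdiv : ∀ k ∈ K, ∀ j ∈ K, k ≠ j → 1 ≤ |((k : ℝ) - j) / ω / ν| := by
    intro k hk j hj hkj
    rw [div_div, abs_div, abs_of_pos (mul_pos hω hν), le_div_iff₀ (mul_pos hω hν)]
    linarith [hK k hk j hj hkj]
  have hsupp : Function.support (weight K ω i) ⊆ K := by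
    intro j hj
    by_contra hjK
    exact hj (by simp [weight, hjK])
  rw [← tsum_subtype_eq_of_support_subset hsupp]
  refine Summable.tsum_le_tsum_of_inj (fun j : K => ⌊((j : ℝ) - i) / ω / ν⌋) ?_ ?_ ?_ ?_ ?_
  · intro a b hab
    by_contra hne
    have h1 := hdiv a a.2 b b.2 (fun h => hne (Subtype.ext h))
    have h2 := Int.abs_sub_lt_one_of_floor_eq_floor hab
    rw [← sub_div, ← sub_div, sub_sub_sub_cancel_right] at h2
    linarith
  · intro c _; positivity
  · rintro ⟨j, hj⟩
    simp only
    by_cases hji : j = i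
    · subst hji
      simp [weight]
      positivity
    set x : ℝ := ((j : ℝ) - i) / ω / ν with hx
    have h1 : 1 ≤ |x| := hdiv j hj i hi hji
    have hw : weight K ω i j = 1 / (1 + (ν * x) ^ 2) := by
      have : (((i : ℝ) - j) / ω) ^ 2 = (ν * x) ^ 2 := by
        rw [hx]; field_simp; ring
      simp [weight, hi, hj, hji, this]
    have hn1 : (⌊x⌋ : ℝ) ≤ x := Int.floor_le x
    have hn2 : x < ⌊x⌋ + 1 := Int.lt_floor_add_one x
    have hx2 : 1 ≤ x ^ 2 := by nlinarith [sq_abs x, abs_nonneg x]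
    have hn3 : (⌊x⌋ : ℝ) ^ 2 ≤ 4 * x ^ 2 := by
      rcases le_abs.1 h1 with h | h
      · have : (0 : ℝ) ≤ ⌊x⌋ := by exact_mod_cast Int.floor_nonneg.2 (by linarith)
        nlinarith
      · nlinarith
    rw [hw, div_mul_div_comm, mul_one, div_le_div_iff₀ (by positivity) (by positivity)]
    nlinarith [sq_nonneg ν, mul_nonneg (sq_nonneg ν) (sub_nonneg.2 hn3),
      mul_nonneg (sq_nonneg ν) (sub_nonneg.2 hx2)]
  · exact (weight_summable K hω i).subtype K
  · exact hZ.mul_left _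

/-! ### Fixed points of contractions of bounded functions -/

lemma exists_bounded_fixedPoint {ι : Type*} [TopologicalSpace ι] [DiscreteTopology ι]
    (T : (ι → ℝ) → ι → ℝ) {θ V : ℝ} (hθ0 : 0 ≤ θ) (hθ : θ < 1) (hV : 0 ≤ V)
    (hT : ∀ (u w : ι → ℝ) (U D : ℝ), (∀ i, |u i| ≤ U) → (∀ i, |w i| ≤ U) →
      (∀ i, |u i - w i| ≤ D) → ∀ i, |T u i - T w i| ≤ θ * D)
    (h0 : ∀ i, |T 0 i| ≤ V) :
    ∃ u : ι → ℝ, (∀ i, |u i| ≤ V / (1 - θ)) ∧ T u = u := by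
  have hTu : ∀ (u : BoundedContinuousFunction ι ℝ) i, |T u i| ≤ θ * ‖u‖ + V := by
    intro u i
    have := hT u 0 ‖u‖ ‖u‖ u.norm_coe_le_norm (fun i => by simp)
      (fun i => by simpa using u.norm_coe_le_norm i) i
    have h' := abs_add_le (T u i - T 0 i) (T 0 i)
    rw [sub_add_cancel] at h'
    linarith [h0 i]
  let F : BoundedContinuousFunction ι ℝ → BoundedContinuousFunction ι ℝ := fun u =>
    BoundedContinuousFunction.ofNormedAddCommGroupDiscrete (T u) _ (hTu u)
  have hF : ContractingWith ⟨θ, hθ0⟩ F := by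
    refine ⟨hθ, LipschitzWith.of_dist_le_mul fun u w => ?_⟩
    rw [BoundedContinuousFunction.dist_le (by positivity)]
    intro i
    refine hT u w (max ‖u‖ ‖w‖) (dist u w) (fun i => (u.norm_coe_le_norm i).trans (le_max_left _ _))
      (fun i => (w.norm_coe_le_norm i).trans (le_max_right _ _)) (fun i => ?_) i
    rw [← Real.dist_eq]; exact BoundedContinuousFunction.dist_coe_le_dist i
  set u := ContractingWith.fixedPoint F hF with hu
  have hfix : F u = u := hF.fixedPoint_isFixedPt
  have hTfix : T u = u := by
    funext i
    exact DFunLike.congr_fun hfix i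
  have hnorm : ‖u‖ ≤ θ * ‖u‖ + V := by
    rw [BoundedContinuousFunction.norm_le (by positivity)]
    intro i
    have := hTu u i
    rwa [hTfix] at this
  refine ⟨u, fun i => (u.norm_coe_le_norm i).trans ?_, hTfix⟩
  rw [le_div_iff₀ (by linarith)]
  linarith

/-! ### Interpolation on a separated set -/

/-- The restriction of `F` to the points of `K` other than `i`, when `i ∈ K`. -/
noncomputable def offDiag (K : Set ℤ) (i : ℤ) (F : ℤ → ℝ) (j : ℤ) : ℝ :=
  open Classical in if i ∈ K ∧ j ∈ K ∧ j ≠ i then F j else 0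

lemma abs_offDiag_le {K : Set ℤ} {ω : ℝ} {i : ℤ} {F : ℤ → ℝ} {M : ℝ}
    (hF : ∀ j ∈ K, |F j| ≤ M / (1 + (((i : ℝ) - j) / ω) ^ 2)) (j : ℤ) :
    ‖offDiag K i F j‖ ≤ M * weight K ω i j := by
  unfold offDiag weight
  split_ifs with h
  · rw [mul_one_div]; exact hF j h.2.1
  · simp

lemma summable_offDiag {K : Set ℤ} {ω : ℝ} (hω : 0 < ω) {i : ℤ} {F : ℤ → ℝ} {M : ℝ}
    (hF : ∀ j ∈ K, |F j| ≤ M / (1 + (((i : ℝ) - j) / ω) ^ 2)) : Summable (offDiag K i F) :=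
  Summable.of_norm_bounded ((weight_summable K hω i).mul_left M) (abs_offDiag_le hF)

lemma abs_tsum_offDiag_le {K : Set ℤ} {ω s : ℝ} (hω : 0 < ω) {i : ℤ}
    (hs : ∑' j, weight K ω i j ≤ s) {F : ℤ → ℝ} {M : ℝ} (hM : 0 ≤ M)
    (hF : ∀ j ∈ K, |F j| ≤ M / (1 + (((i : ℝ) - j) / ω) ^ 2)) :
    |∑' j, offDiag K i F j| ≤ M * s := by
  have := tsum_of_norm_bounded (((weight_summable K hω i).mul_left M).hasSum) (abs_offDiag_le hF)
  rw [tsum_mul_left] at this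
  exact this.trans (mul_le_mul_of_nonneg_left hs hM)

lemma abs_mul_add_mul_le {a b x y A X : ℝ} (ha : |a| ≤ A) (hb : |b| ≤ A) (hx : |x| ≤ X)
    (hy : |y| ≤ X) : |a * x + b * y| ≤ 2 * A * X := by
  have hA := (abs_nonneg _).trans ha
  have h1 : |a * x| ≤ A * X := by
    rw [abs_mul]; exact mul_le_mul ha hx (abs_nonneg _) hA
  have h2 : |b * y| ≤ A * X := by
    rw [abs_mul]; exact mul_le_mul hb hy (abs_nonneg _) hA
  linarith [abs_add_le (a * x) (b * y)]

/-- If the sampling point `k` is close to `i ∈ K`, or if `i` is a point of `K` nearest to `k`, the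
decay seen from `k` is comparable to the decay seen from `i`. -/
lemma decay_transfer {K : Set ℤ} {ω ε : ℝ} {i k : ℤ}
    (h : |((k : ℝ) - i) / ω| ≤ ε ∨ ∀ j ∈ K, |(k : ℝ) - i| ≤ |(k : ℝ) - j|) {j : ℤ} (hj : j ∈ K) :
    1 / (1 + (((k : ℝ) - j) / ω) ^ 2) ≤ 4 * (1 + ε ^ 2) / (1 + (((i : ℝ) - j) / ω) ^ 2) := by
  set x := ((k : ℝ) - i) / ω
  set y := ((i : ℝ) - j) / ω
  have hxy : ((k : ℝ) - j) / ω = x + y := by simp only [x, y]; ring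
  rw [hxy, div_le_div_iff₀ (by positivity) (by positivity)]
  rcases h with h | h
  · have hx : x ^ 2 ≤ ε ^ 2 := sq_le_sq' (by linarith [abs_le.1 h]) (by linarith [abs_le.1 h])
    nlinarith [sq_nonneg (y + 2 * x), mul_nonneg (sq_nonneg ε) (sq_nonneg (x + y))]
  · have hx : x ^ 2 ≤ (x + y) ^ 2 := by
      rw [← hxy]
      simp only [x]
      rw [sq_le_sq, abs_div, abs_div]
      exact div_le_div_of_nonneg_right (h j hj) (abs_nonneg _)
    nlinarith [sq_nonneg (y + 2 * x), mul_nonneg (sq_nonneg ε) (sq_nonneg (x + y))]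

/-- The value at `k` of `∑ α_j p_j + ∑ b_j o_j`, where `p_j`, `o_j` are the pulses `p`, `o` moved
to `j` and sampled at scale `ω`. -/
noncomputable def synth (ω : ℝ) (p o : ℝ → ℝ) (α b : ℤ → ℝ) (k : ℤ) : ℝ :=
  ∑' j : ℤ, (α j * p (((k : ℝ) - j) / ω) + b j * o (((k : ℝ) - j) / ω))

lemma synth_eq_add_offDiag {p p₁ p₂ o o₁ o₂ : ℝ → ℝ} {B ω : ℝ} (hω : 0 < ω)
    (hp : Pulse p p₁ p₂ B) (ho : Pulse o o₁ o₂ B) {K : Set ℤ} {α b : ℤ → ℝ} {U : ℝ}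
    (hα : ∀ j, |α j| ≤ U) (hb : ∀ j, |b j| ≤ U) (hαK : ∀ j, j ∉ K → α j = 0)
    (hbK : ∀ j, j ∉ K → b j = 0) {i : ℤ} (hi : i ∈ K) (k : ℤ) :
    synth ω p o α b k = α i * p (((k : ℝ) - i) / ω) + b i * o (((k : ℝ) - i) / ω)
      + ∑' j, offDiag K i
          (fun j => α j * p (((k : ℝ) - j) / ω) + b j * o (((k : ℝ) - j) / ω)) j := by
  have hs := (summable_mul_decay hω hp.bound₀ hα k).add (summable_mul_decay hω ho.bound₀ hb k)
  rw [synth, hs.tsum_eq_add_tsum_ite i]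
  congr 1
  refine tsum_congr fun j => ?_
  unfold offDiag
  by_cases hji : j = i
  · simp [hji]
  · by_cases hjK : j ∈ K
    · simp [hji, hjK, hi]
    · simp [hji, hjK, hαK j hjK, hbK j hjK]

lemma abs_pair_le {φ ψ : ℝ → ℝ} {B : ℝ} (hφ : ∀ t, |φ t| ≤ B / (1 + t ^ 2))
    (hψ : ∀ t, |ψ t| ≤ B / (1 + t ^ 2)) {α b : ℤ → ℝ} {U : ℝ} (hα : ∀ i, |α i| ≤ U)
    (hb : ∀ i, |b i| ≤ U) (ω : ℝ) (i j : ℤ) :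
    |α j * φ (((i : ℝ) - j) / ω) + b j * ψ (((i : ℝ) - j) / ω)|
      ≤ (2 * U * B) / (1 + (((i : ℝ) - j) / ω) ^ 2) := by
  have := abs_mul_add_mul_le (hα j) (hb j) (hφ (((i : ℝ) - j) / ω)) (hψ (((i : ℝ) - j) / ω))
  rwa [← mul_div_assoc] at this

/-- Coefficients of the interpolant: the first equation prescribes its value at `i ∈ K`, the second
one cancels its derivative there when `e = 1 / o₁ 0`. The system is a perturbation of the identity
by the interactions of distinct points. -/
lemma exists_coefficients {B l₀ e₀ s ω : ℝ} (hB : 0 ≤ B) (hl₀ : 0 < l₀) (he₀ : 0 ≤ e₀)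
    (hs0 : 0 ≤ s) (hω : 0 < ω) {K : Set ℤ} (hW : ∀ i, ∑' j, weight K ω i j ≤ s)
    (hθ2 : 2 * B * (1 / l₀ + e₀) * s ≤ 1 / 2)
    {p p₁ p₂ o o₁ o₂ : ℝ → ℝ} (hp : Pulse p p₁ p₂ B) (ho : Pulse o o₁ o₂ B) (hp0 : l₀ ≤ p 0)
    {e : ℝ} (he : |e| ≤ e₀) {v : ℤ → ℝ} (hv : ∀ i, |v i| ≤ 1) (hvK : ∀ i, i ∉ K → v i = 0) :
    ∃ α b : ℤ → ℝ, (∀ i, i ∉ K → α i = 0) ∧ (∀ i, i ∉ K → b i = 0) ∧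
      (∀ i, |α i| ≤ 2) ∧ (∀ i, |b i| ≤ 2) ∧
      (∀ i, |α i - v i| ≤ 2 * (2 * B * (1 / l₀ + e₀) * s)) ∧
      (∀ i, |b i| ≤ 2 * (2 * B * (1 / l₀ + e₀) * s)) ∧
      (∀ i, p 0 * α i + ∑' j, offDiag K i
        (fun j => α j * p (((i : ℝ) - j) / ω) + b j * o (((i : ℝ) - j) / ω)) j = p 0 * v i) ∧
      (∀ i, b i = -e * ∑' j, offDiag K i
        (fun j => α j * p₁ (((i : ℝ) - j) / ω) + b j * o₁ (((i : ℝ) - j) / ω)) j) := by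
  set θ : ℝ := 2 * B * (1 / l₀ + e₀) * s with hθ
  have hθ0 : 0 ≤ θ := by positivity
  have hl : |1 / p 0| ≤ 1 / l₀ := by
    rw [abs_of_nonneg (one_div_nonneg.2 (hl₀.le.trans hp0))]
    exact one_div_le_one_div_of_le hl₀ hp0
  set X : (ℝ → ℝ) → (ℝ → ℝ) → (ℤ × Bool → ℝ) → ℤ → ℝ := fun φ ψ u i =>
    ∑' j, offDiag K i (fun j => u (j, false) * φ (((i : ℝ) - j) / ω)
      + u (j, true) * ψ (((i : ℝ) - j) / ω)) j with hX
  have hXsub : ∀ {φ ψ : ℝ → ℝ}, (∀ t, |φ t| ≤ B / (1 + t ^ 2)) → (∀ t, |ψ t| ≤ B / (1 + t ^ 2)) →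
      ∀ (u w : ℤ × Bool → ℝ) (U D : ℝ), (∀ i, |u i| ≤ U) → (∀ i, |w i| ≤ U) →
      (∀ i, |u i - w i| ≤ D) → ∀ i, |X φ ψ u i - X φ ψ w i| ≤ 2 * D * B * s := by
    intro φ ψ hφ hψ u w U D hu hw huw i
    have hD : 0 ≤ D := (abs_nonneg _).trans (huw (0, false))
    have hsub : X φ ψ u i - X φ ψ w i = ∑' j, offDiag K i (fun j =>
        (u (j, false) - w (j, false)) * φ (((i : ℝ) - j) / ω)
          + (u (j, true) - w (j, true)) * ψ (((i : ℝ) - j) / ω)) j := by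
      simp only [hX]
      rw [← (summable_offDiag hω fun j _ => abs_pair_le hφ hψ (fun i => hu (i, false))
          (fun i => hu (i, true)) ω i j).tsum_sub
        (summable_offDiag hω fun j _ => abs_pair_le hφ hψ (fun i => hw (i, false))
          (fun i => hw (i, true)) ω i j)]
      refine tsum_congr fun j => ?_
      simp only [offDiag]
      split_ifs <;> ring
    rw [hsub]
    exact abs_tsum_offDiag_le hω (hW i) (by positivity) fun j _ =>
      abs_pair_le hφ hψ (fun i => huw (i, false)) (fun i => huw (i, true)) ω i j
  set T : (ℤ × Bool → ℝ) → ℤ × Bool → ℝ := fun u i =>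
    if i.2 then - e * X p₁ o₁ u i.1 else v i.1 - 1 / p 0 * X p o u i.1 with hT
  have hX0 : ∀ φ ψ i, X φ ψ 0 i = 0 := by
    intro φ ψ i
    simp [hX, offDiag]
  have hTlip : ∀ (u w : ℤ × Bool → ℝ) (U D : ℝ), (∀ i, |u i| ≤ U) → (∀ i, |w i| ≤ U) →
      (∀ i, |u i - w i| ≤ D) → ∀ i, |T u i - T w i| ≤ θ * D := by
    rintro u w U D hu hw huw ⟨i, t⟩
    have hD : 0 ≤ D := (abs_nonneg _).trans (huw (0, false))
    have hi0 : 0 ≤ 2 * D * B * s := by positivity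
    have hl0 : 0 ≤ 1 / l₀ := by positivity
    cases t
    · have h1 := hXsub hp.bound₀ ho.bound₀ u w U D hu hw huw i
      have : T u (i, false) - T w (i, false) = -(1 / p 0 * (X p o u i - X p o w i)) := by
        simp only [hT, Bool.false_eq_true, if_false]; ring
      rw [this, abs_neg, abs_mul]
      calc _ ≤ 1 / l₀ * (2 * D * B * s) := mul_le_mul hl h1 (abs_nonneg _) hl0
        _ ≤ 1 / l₀ * (2 * D * B * s) + e₀ * (2 * D * B * s) := by
            linarith [mul_nonneg he₀ hi0]
        _ = θ * D := by rw [hθ]; ring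
    · have h1 := hXsub hp.bound₁ ho.bound₁ u w U D hu hw huw i
      have : T u (i, true) - T w (i, true) = -(e * (X p₁ o₁ u i - X p₁ o₁ w i)) := by
        simp only [hT, if_true]; ring
      rw [this, abs_neg, abs_mul]
      calc _ ≤ e₀ * (2 * D * B * s) := mul_le_mul he h1 (abs_nonneg _) he₀
        _ ≤ 1 / l₀ * (2 * D * B * s) + e₀ * (2 * D * B * s) := by
            linarith [mul_nonneg hl0 hi0]
        _ = θ * D := by rw [hθ]; ring
  have hT0f : ∀ i, T 0 (i, false) = v i := by
    intro i; simp only [hT, hX0]; simp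
  have hT0t : ∀ i, T 0 (i, true) = 0 := by
    intro i; simp only [hT, hX0]; simp
  obtain ⟨u, hu1, hu⟩ := exists_bounded_fixedPoint T hθ0 (by linarith) zero_le_one hTlip (by
    rintro ⟨i, t⟩
    cases t
    · rw [hT0f]; exact hv i
    · rw [hT0t]; simp)
  have hu2 : ∀ i, |u i| ≤ 2 := fun i => (hu1 i).trans (by
    rw [div_le_iff₀ (by linarith)]; linarith)
  have hdist : ∀ i, |u i - T 0 i| ≤ 2 * θ := by
    intro i
    have := hTlip u 0 2 2 hu2 (by simp) (by simpa using hu2) i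
    rw [hu] at this
    linarith
  have hXK : ∀ φ ψ i, i ∉ K → X φ ψ u i = 0 := by
    intro φ ψ i hi; simp [hX, offDiag, hi]
  have hαeq : ∀ i, u (i, false) = v i - 1 / p 0 * X p o u i := by
    intro i
    have := congrFun hu (i, false)
    simp only [hT, Bool.false_eq_true, if_false] at this
    exact this.symm
  have hbeq : ∀ i, u (i, true) = -e * X p₁ o₁ u i := by
    intro i
    have := congrFun hu (i, true)
    simp only [hT, if_true] at this
    exact this.symm
  refine ⟨fun i => u (i, false), fun i => u (i, true), ?_, ?_, fun i => hu2 _, fun i => hu2 _,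
    ?_, ?_, ?_, hbeq⟩
  · intro i hi
    simp only [hαeq, hXK _ _ _ hi, hvK i hi]; simp
  · intro i hi
    simp only [hbeq, hXK _ _ _ hi]; simp
  · intro i
    have := hdist (i, false); rwa [hT0f] at this
  · intro i
    have := hdist (i, true); rwa [hT0t, sub_zero] at this
  · intro i
    have h1 : ∑' j, offDiag K i (fun j => u (j, false) * p (((i : ℝ) - j) / ω)
        + u (j, true) * o (((i : ℝ) - j) / ω)) j = X p o u i := rfl
    have := (hl₀.trans_le hp0).ne'
    simp only [h1]
    rw [hαeq i]
    field_simp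
    ring

lemma abs_offDiag_sub_linear_le {p p₁ p₂ o o₁ o₂ : ℝ → ℝ} {B ω ε s : ℝ} (hω : 0 < ω)
    (hp : Pulse p p₁ p₂ B) (ho : Pulse o o₁ o₂ B) {K : Set ℤ} (hs0 : 0 ≤ s)
    (hW : ∀ i, ∑' j, weight K ω i j ≤ s) {α b : ℤ → ℝ} (hα : ∀ j, |α j| ≤ 2)
    (hb : ∀ j, |b j| ≤ 2) {i k : ℤ} (hk : |((k : ℝ) - i) / ω| ≤ ε) :
    |(∑' j, offDiag K i (fun j => α j * p (((k : ℝ) - j) / ω) + b j * o (((k : ℝ) - j) / ω)) j)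
      - (∑' j, offDiag K i (fun j => α j * p (((i : ℝ) - j) / ω) + b j * o (((i : ℝ) - j) / ω)) j)
      - ((k : ℝ) - i) / ω * ∑' j, offDiag K i
        (fun j => α j * p₁ (((i : ℝ) - j) / ω) + b j * o₁ (((i : ℝ) - j) / ω)) j|
      ≤ 4 * (4 * (1 + ε ^ 2)) * B * s * (((k : ℝ) - i) / ω) ^ 2 := by
  have hB := hp.nonneg
  set t : ℝ := ((k : ℝ) - i) / ω with ht
  set Y : ℤ → ℝ := fun j =>
    α j * (p (((k : ℝ) - j) / ω) - p (((i : ℝ) - j) / ω) - p₁ (((i : ℝ) - j) / ω) * t)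
    + b j * (o (((k : ℝ) - j) / ω) - o (((i : ℝ) - j) / ω) - o₁ (((i : ℝ) - j) / ω) * t)
    with hY
  have hsplit : ∀ j : ℤ, ((k : ℝ) - j) / ω = ((i : ℝ) - j) / ω + t := by
    intro j; rw [ht]; ring
  have hYb : ∀ j ∈ K, |Y j|
      ≤ (2 * 2 * (2 * (1 + ε ^ 2) * B * t ^ 2)) / (1 + (((i : ℝ) - j) / ω) ^ 2) := by
    intro j _
    have h1 := hp.abs_sub_linear_le hk (((i : ℝ) - j) / ω)
    have h2 := ho.abs_sub_linear_le hk (((i : ℝ) - j) / ω)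
    rw [← hsplit, div_mul_eq_mul_div] at h1 h2
    exact (abs_mul_add_mul_le (hα j) (hb j) h1 h2).trans_eq (by ring)
  have hYs := abs_tsum_offDiag_le hω (hW i) (by positivity) hYb
  have hsum : ∀ {φ ψ : ℝ → ℝ}, (∀ t, |φ t| ≤ B / (1 + t ^ 2)) → (∀ t, |ψ t| ≤ B / (1 + t ^ 2)) →
      Summable (offDiag K i
        (fun j => α j * φ (((i : ℝ) - j) / ω) + b j * ψ (((i : ℝ) - j) / ω))) :=
    fun hφ hψ => summable_offDiag hω fun j _ => abs_pair_le hφ hψ hα hb ω i j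
  have hsumk : Summable (offDiag K i
      (fun j => α j * p (((k : ℝ) - j) / ω) + b j * o (((k : ℝ) - j) / ω))) := by
    refine summable_offDiag hω (ω := ω) (M := 2 * 2 * B * (4 * (1 + ε ^ 2))) fun j hj => ?_
    refine (abs_pair_le hp.bound₀ ho.bound₀ hα hb ω k j).trans ?_
    rw [← mul_one_div, mul_div_assoc]
    exact mul_le_mul_of_nonneg_left (decay_transfer (Or.inl hk) hj) (by positivity)
  rw [← hsumk.tsum_sub (hsum hp.bound₀ ho.bound₀), ← tsum_mul_left,
    ← (hsumk.sub (hsum hp.bound₀ ho.bound₀)).tsum_sub ((hsum hp.bound₁ ho.bound₁).mul_left t)]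
  have hcongr : ∀ j, offDiag K i
        (fun j => α j * p (((k : ℝ) - j) / ω) + b j * o (((k : ℝ) - j) / ω)) j
      - offDiag K i (fun j => α j * p (((i : ℝ) - j) / ω) + b j * o (((i : ℝ) - j) / ω)) j
      - t * offDiag K i (fun j => α j * p₁ (((i : ℝ) - j) / ω) + b j * o₁ (((i : ℝ) - j) / ω)) j
      = offDiag K i Y j := by
    intro j
    simp only [offDiag, hY]
    split_ifs <;> ring
  rw [tsum_congr hcongr]
  refine hYs.trans ?_
  have : 0 ≤ (1 + ε ^ 2) * B * s * t ^ 2 := by positivity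
  linarith

/-- On a sufficiently separated set `K` one can interpolate any values bounded by `1` by translates
of a pulse `p`, corrected by translates of a pulse `o` so that, to second order, the sum of the
contributions of the other points is stationary at each point of `K`. The sum then deviates from
the single pulse at `i` by `η t²` near `i`, and by `η` wherever `i` is the nearest point. When the
sampling is coarse (`ω ε ≤ 2`) stationarity is irrelevant, since distinct samples are at distance
at least `ε / 2`. -/
lemma exists_interpolation {B ε l₀ e₀ η : ℝ} (hB : 0 ≤ B) (hε : 0 < ε) (hl₀ : 0 < l₀)
    (he₀ : 0 ≤ e₀) (hη : 0 < η) :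
    ∃ ν₀ : ℝ, 1 ≤ ν₀ ∧ ∀ ν, ν₀ ≤ ν → ∀ ω, 0 < ω → ∀ K : Set ℤ,
      (∀ k ∈ K, ∀ j ∈ K, k ≠ j → ν * ω ≤ |(k : ℝ) - j|) →
      ∀ p p₁ p₂ o o₁ o₂ : ℝ → ℝ, Pulse p p₁ p₂ B → Pulse o o₁ o₂ B → o 0 = 0 → l₀ ≤ p 0 →
      ∀ e, |e| ≤ e₀ → (e * o₁ 0 = 1 ∨ ω * ε ≤ 2) →
      ∀ v : ℤ → ℝ, (∀ i, |v i| ≤ 1) → (∀ i, i ∉ K → v i = 0) →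
      ∃ α b : ℤ → ℝ, (∀ i, i ∉ K → α i = 0) ∧ (∀ i, i ∉ K → b i = 0) ∧
        (∀ i, |α i - v i| ≤ η) ∧ (∀ i, |b i| ≤ η) ∧
        (∀ i ∈ K, synth ω p o α b i = p 0 * v i) ∧
        (∀ i ∈ K, ∀ k : ℤ, |((k : ℝ) - i) / ω| ≤ ε →
          |synth ω p o α b k - p 0 * v i - α i * (p (((k : ℝ) - i) / ω) - p 0)|
            ≤ η * (((k : ℝ) - i) / ω) ^ 2) ∧
        (∀ i ∈ K, ∀ k : ℤ,
          (|((k : ℝ) - i) / ω| ≤ ε ∨ ∀ j ∈ K, |(k : ℝ) - i| ≤ |(k : ℝ) - j|) →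
          |synth ω p o α b k - α i * p (((k : ℝ) - i) / ω)| ≤ η) := by
  set Z : ℝ := ∑' n : ℤ, 1 / (1 + (n : ℝ) ^ 2)
  have hZ : 0 ≤ Z := tsum_nonneg fun n => by positivity
  set m : ℝ := 4 * (1 + ε ^ 2) with hm
  set c : ℝ := 2 * B * (1 / l₀ + e₀) with hc
  have hc0 : 0 ≤ c := by positivity
  have hm1 : 1 ≤ m := by nlinarith [sq_nonneg ε]
  set Q : ℝ := 2 * c + 2 * c * B * m + 8 * B * m with hQ
  have hQ0 : 0 ≤ Q := by positivity
  set Q' : ℝ := Q * (1 + 4 / ε ^ 2) with hQ'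
  have hQQ' : Q ≤ Q' := le_mul_of_one_le_right hQ0 (by linarith [show 0 ≤ 4 / ε ^ 2 by positivity])
  set d := min η 1
  have hd : 0 < d := lt_min hη one_pos
  refine ⟨max 1 (16 * Z * (Q' + 1) / d), le_max_left _ _, ?_⟩
  intro ν hν ω hω K hK p p₁ p₂ o o₁ o₂ hp ho ho0 hp0 e he hor v hv hvK
  have hν1 : 1 ≤ ν := (le_max_left _ _).trans hν
  set s : ℝ := 8 / ν ^ 2 * Z with hs
  have hs0 : 0 ≤ s := by positivity
  have hsQ' : 2 * (s * (Q' + 1)) ≤ d := by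
    have h1 := (div_le_iff₀ hd).1 ((le_max_right _ _).trans hν)
    have h2 : ν * d ≤ ν ^ 2 * d := mul_le_mul_of_nonneg_right (by nlinarith) hd.le
    have h3 : 2 * (s * (Q' + 1)) = 16 * Z * (Q' + 1) / ν ^ 2 := by rw [hs]; ring
    rw [h3, div_le_iff₀ (by positivity)]
    linarith
  have hQ'0 : 0 ≤ s * Q' := mul_nonneg hs0 (hQ0.trans hQQ')
  have hsQη : s * Q' ≤ η := by linarith [min_le_left η 1]
  have hsQ : s * Q ≤ s * Q' := mul_le_mul_of_nonneg_left hQQ' hs0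
  have hs1 : 2 * (s * Q) ≤ 1 := by linarith [min_le_right η 1]
  have hW : ∀ i, ∑' j, weight K ω i j ≤ s := tsum_weight_le hω (by linarith) hK
  set θ : ℝ := c * s with hθ
  have hθ0 : 0 ≤ θ := by positivity
  have hθQ : 2 * θ + (2 * c * B * m + 8 * B * m) * s = s * Q := by rw [hθ, hQ]; ring
  have hBms : 0 ≤ B * m * s := by positivity
  have hcBms : 0 ≤ 2 * c * B * m * s := by positivity
  obtain ⟨α, b, hαK, hbK, hα2, hb2, hαv, hbb, hαeq, hbeq⟩ :=
    exists_coefficients hB hl₀ he₀ hs0 hω hW (by linarith) hp ho hp0 he hv hvK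
  rw [← hc, ← hθ] at hαv hbb
  set R : ℤ → ℤ → ℝ := fun i k => ∑' j, offDiag K i
    (fun j => α j * p (((k : ℝ) - j) / ω) + b j * o (((k : ℝ) - j) / ω)) j with hR
  have hsyn : ∀ i ∈ K, ∀ k, synth ω p o α b k =
      α i * p (((k : ℝ) - i) / ω) + b i * o (((k : ℝ) - i) / ω) + R i k :=
    fun i hi k => synth_eq_add_offDiag hω hp ho hα2 hb2 hαK hbK hi k
  have hRb : ∀ i k : ℤ,
      (|((k : ℝ) - i) / ω| ≤ ε ∨ ∀ j ∈ K, |(k : ℝ) - i| ≤ |(k : ℝ) - j|) →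
      |R i k| ≤ 4 * B * m * s := by
    intro i k hik
    refine abs_tsum_offDiag_le hω (hW i) (by positivity) fun j hj => ?_
    refine (abs_pair_le hp.bound₀ ho.bound₀ hα2 hb2 ω k j).trans ?_
    rw [← mul_one_div, mul_div_assoc, show (2 : ℝ) * 2 = 4 by norm_num]
    exact mul_le_mul_of_nonneg_left (decay_transfer hik hj) (by positivity)
  have hii : ∀ i : ℤ, |((i : ℝ) - i) / ω| ≤ ε := by intro i; simpa using hε.le
  have hval : ∀ i ∈ K, synth ω p o α b i = p 0 * v i := by
    intro i hi
    rw [hsyn i hi, ← hαeq i]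
    simp only [sub_self, zero_div, ho0, hR]
    ring
  have hθB : 2 * θ * B ≤ 2 * c * B * m * s := by
    have : 0 ≤ c * B * s := by positivity
    rw [hθ]
    nlinarith
  have hbo : ∀ i t, |b i * o t| ≤ 2 * θ * B := by
    intro i t
    rw [abs_mul]
    exact mul_le_mul (hbb i) (ho.le_bound t) (abs_nonneg _) (by positivity)
  refine ⟨α, b, hαK, hbK, fun i => (hαv i).trans (by linarith),
    fun i => (hbb i).trans (by linarith), hval, ?_, ?_⟩
  · intro i hi k hk
    have hRi := hRb i i (Or.inl (hii i))
    have hRk := hRb i k (Or.inl hk)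
    have hlinear := abs_offDiag_sub_linear_le hω hp ho hs0 hW hα2 hb2 hk
    set t : ℝ := ((k : ℝ) - i) / ω with ht
    have hdec : synth ω p o α b k - p 0 * v i - α i * (p t - p 0)
        = b i * o t + (R i k - R i i) := by
      rw [← hval i hi, hsyn i hi k, hsyn i hi i]
      simp only [sub_self, zero_div, ho0, ← ht]
      ring
    rw [hdec]
    rcases hor with hor | hor
    · -- fine sampling: the first order terms at `i` cancel by the choice of `b i`
      set X := ∑' j, offDiag K i
        (fun j => α j * p₁ (((i : ℝ) - j) / ω) + b j * o₁ (((i : ℝ) - j) / ω)) j with hX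
      have hlin : b i * o₁ 0 + X = 0 := by
        rw [hbeq]; linear_combination (-X) * hor
      have hoi := ho.abs_sub_linear_le hk 0
      simp only [zero_add, ho0, sub_zero] at hoi
      have hfin : b i * o t + (R i k - R i i)
          = b i * (o t - o₁ 0 * t) + (R i k - R i i - t * X) := by
        linear_combination t * hlin
      rw [hfin]
      have h1 : |b i * (o t - o₁ 0 * t)| ≤ 2 * θ * (m * B * t ^ 2) := by
        rw [abs_mul]
        refine mul_le_mul (hbb i) (hoi.trans ?_) (abs_nonneg _) (by positivity)
        rw [zero_pow two_ne_zero, add_zero, div_one]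
        have : 0 ≤ (1 + ε ^ 2) * B * t ^ 2 := by positivity
        rw [hm]
        linarith
      refine (abs_add_le _ _).trans ((add_le_add h1 hlinear).trans ?_)
      calc _ = (2 * c * B * m * s + 4 * B * m * s) * t ^ 2 := by rw [hθ, hm]; ring
        _ ≤ η * t ^ 2 := by
          refine mul_le_mul_of_nonneg_right ?_ (sq_nonneg t)
          linarith
    · -- coarse sampling: distinct samples are at distance at least `ε / 2`
      by_cases hki : k = i
      · subst hki
        simp [ht, ho0]
      have h1 : (1 : ℝ) ≤ |(k : ℝ) - i| := by
        have : (1 : ℤ) ≤ |k - i| := Int.one_le_abs (sub_ne_zero.2 hki)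
        exact_mod_cast this
      have h2 : 1 ≤ 4 / ε ^ 2 * t ^ 2 := by
        have h3 : ε / 2 ≤ |t| := by
          rw [ht, abs_div, abs_of_pos hω, le_div_iff₀ hω]
          linarith
        have h4 : (ε / 2) ^ 2 ≤ t ^ 2 := by
          rw [← sq_abs t]; exact pow_le_pow_left₀ (by positivity) h3 2
        rw [div_mul_eq_mul_div, le_div_iff₀ (by positivity)]
        linarith
      have h5 : |b i * o t + (R i k - R i i)| ≤ s * Q := by
        have h6 := abs_add_le (b i * o t) (R i k - R i i)
        have h7 := abs_sub (R i k) (R i i)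
        linarith [hbo i t]
      calc _ ≤ s * Q := h5
        _ ≤ s * Q * (4 / ε ^ 2 * t ^ 2) := le_mul_of_one_le_right (by positivity) h2
        _ = (s * Q * (4 / ε ^ 2)) * t ^ 2 := by ring
        _ ≤ η * t ^ 2 := by
          refine mul_le_mul_of_nonneg_right ?_ (sq_nonneg t)
          have : s * Q' = s * Q + s * Q * (4 / ε ^ 2) := by rw [hQ']; ring
          linarith [mul_nonneg hs0 hQ0]
  · intro i hi k hk
    have h1 : synth ω p o α b k - α i * p (((k : ℝ) - i) / ω)
        = b i * o (((k : ℝ) - i) / ω) + R i k := by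
      rw [hsyn i hi k]; ring
    rw [h1]
    have h2 := abs_add_le (b i * o (((k : ℝ) - i) / ω)) (R i k)
    linarith [hbo i (((k : ℝ) - i) / ω), hRb i k hk]

/-! ### Admissible kernels -/

namespace IsAdmissibleKernel

variable {g : ℝ → ℝ} {C : Fin 4 → ℝ} {ε β : ℝ}

lemma pulse (hg : IsAdmissibleKernel g C ε β) :
    Pulse g (deriv g) (iteratedDeriv 2 g) (C 0 + C 1 + C 2) where
  deriv₁ t := (hg.contDiff.differentiable (by norm_num) t).hasDerivAt
  deriv₂ t := by
    have h : Differentiable ℝ (iteratedDeriv 1 g) :=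
      hg.contDiff.differentiable_iteratedDeriv 1 (by norm_num)
    rw [iteratedDeriv_succ, ← iteratedDeriv_one]
    exact (h t).hasDerivAt
  bound₀ t := by
    have := hg.global_bound 0 t
    simp only [Fin.val_zero, iteratedDeriv_zero] at this
    exact this.trans (by gcongr; linarith [hg.const_pos 1, hg.const_pos 2])
  bound₁ t := by
    have := hg.global_bound 1 t
    simp only [Fin.val_one, iteratedDeriv_one] at this
    exact this.trans (by gcongr; linarith [hg.const_pos 0, hg.const_pos 2])
  bound₂ t := by
    have := hg.global_bound 2 t
    simp only [Fin.val_two] at this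
    exact this.trans (by gcongr; linarith [hg.const_pos 0, hg.const_pos 1])

lemma pos (hg : IsAdmissibleKernel g C ε β) : 0 < g 0 :=
  hg.pos_near 0 (by simpa using hg.eps_pos.le)

lemma abs_deriv2_le (hg : IsAdmissibleKernel g C ε β) (t : ℝ) : |iteratedDeriv 2 g t| ≤ C 2 := by
  have := hg.global_bound 2 t
  simp only [Fin.val_two] at this
  exact this.trans (div_le_self (hg.const_pos 2).le (by nlinarith [sq_nonneg t]))

lemma deriv_neg (hg : IsAdmissibleKernel g C ε β) (t : ℝ) : deriv g (-t) = -deriv g t := by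
  have h : (fun s => g (-s)) = g := funext hg.even
  have := deriv_comp_neg g t
  rw [h] at this
  linarith

lemma deriv_zero (hg : IsAdmissibleKernel g C ε β) : deriv g 0 = 0 := by
  have := hg.deriv_neg 0
  rw [neg_zero] at this
  linarith

/-- By compactness the strict concavity bound leaves some room. -/
lemma exists_concave_room (hg : IsAdmissibleKernel g C ε β) :
    ∃ β₁, β < β₁ ∧ ∀ t, |t| ≤ ε → iteratedDeriv 2 g t ≤ -β₁ := by
  have hc : ContinuousOn (iteratedDeriv 2 g) (Set.Icc (-ε) ε) :=
    (hg.contDiff.continuous_iteratedDeriv 2 (by norm_num)).continuousOn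
  obtain ⟨x, hx, hmax⟩ := isCompact_Icc.exists_isMaxOn
    (Set.nonempty_Icc.2 (by linarith [hg.eps_pos])) hc
  refine ⟨-iteratedDeriv 2 g x, by linarith [hg.concave_near x (abs_le.2 hx)], fun t ht => ?_⟩
  have := hmax (abs_le.1 ht)
  simpa using this

lemma le_sub_sq (hg : IsAdmissibleKernel g C ε β) {β₁ : ℝ}
    (h : ∀ t, |t| ≤ ε → iteratedDeriv 2 g t ≤ -β₁) {t : ℝ} (ht : |t| ≤ ε) :
    g t ≤ g 0 - β₁ / 2 * t ^ 2 := by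
  have hconc : ConcaveOn ℝ (Set.Icc (-ε) ε) fun s => g s + β₁ / 2 * s ^ 2 := by
    have hd : ∀ s : ℝ, HasDerivAt (fun s => g s + β₁ / 2 * s ^ 2) (deriv g s + β₁ * s) s := by
      intro s
      have := (hg.pulse.deriv₁ s).add ((hasDerivAt_pow 2 s).const_mul (β₁ / 2))
      rw [show β₁ * s = β₁ / 2 * (((2 : ℕ) : ℝ) * s ^ (2 - 1)) by
        rw [Nat.cast_ofNat, show 2 - 1 = 1 from rfl, pow_one]; ring]
      exact this
    have hd2 : ∀ s : ℝ, HasDerivAt (fun s => deriv g s + β₁ * s) (iteratedDeriv 2 g s + β₁) s := by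
      intro s
      have := (hg.pulse.deriv₂ s).add ((hasDerivAt_id s).const_mul β₁)
      rw [mul_one] at this
      exact this
    refine concaveOn_of_hasDerivWithinAt2_nonpos (convex_Icc _ _)
      (fun s _ => (hd s).continuousAt.continuousWithinAt)
      (fun s _ => (hd s).hasDerivWithinAt) (fun s _ => (hd2 s).hasDerivWithinAt) ?_
    intro s hs
    rw [interior_Icc] at hs
    linarith [h s (abs_le.2 ⟨hs.1.le, hs.2.le⟩)]
  have h2 := hconc.2 (abs_le.1 ht) (show -t ∈ Set.Icc (-ε) ε from abs_le.1 (by rwa [abs_neg]))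
    (show (0 : ℝ) ≤ 1 / 2 by norm_num) (show (0 : ℝ) ≤ 1 / 2 by norm_num) (by norm_num)
  simp only [smul_eq_mul, hg.even] at h2
  have h0 : (1 / 2 * t + 1 / 2 * -t) = 0 := by ring
  rw [h0] at h2
  linarith

lemma le_sub_far (hg : IsAdmissibleKernel g C ε β) {β₁ : ℝ}
    (h : ∀ t, |t| ≤ ε → iteratedDeriv 2 g t ≤ -β₁) {t : ℝ} (ht : ε < |t|) :
    g t ≤ g 0 - β₁ / 2 * ε ^ 2 :=
  (hg.lt_far t ht).le.trans (hg.le_sub_sq h (abs_of_pos hg.eps_pos).le)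

lemma le_zero (hg : IsAdmissibleKernel g C ε β) (t : ℝ) : g t ≤ g 0 := by
  have hβ := hg.beta_pos
  have h : ∀ t, |t| ≤ ε → iteratedDeriv 2 g t ≤ -β := fun t ht => (hg.concave_near t ht).le
  rcases le_or_gt (|t|) ε with ht | ht
  · have := hg.le_sub_sq h ht
    have : 0 ≤ β / 2 * t ^ 2 := by positivity
    linarith
  · have := hg.le_sub_far h ht
    have : 0 ≤ β / 2 * ε ^ 2 := by positivity
    linarith

lemma deriv_le_neg (hg : IsAdmissibleKernel g C ε β) {s : ℝ} (hs0 : 0 ≤ s) (hs : s ≤ ε) :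
    deriv g s ≤ -β * s := by
  have := Convex.image_sub_le_mul_sub_of_deriv_le (convex_Icc (0 : ℝ) ε) (f := deriv g) (C := -β)
    (fun t _ => (hg.pulse.deriv₂ t).continuousAt.continuousWithinAt)
    (fun t _ => (hg.pulse.deriv₂ t).differentiableAt.differentiableWithinAt)
    (fun t ht => by
      rw [interior_Icc] at ht
      rw [(hg.pulse.deriv₂ t).deriv]
      exact (hg.concave_near t (abs_le.2 ⟨by linarith [ht.1, hg.eps_pos], ht.2.le⟩)).le)
    0 ⟨le_rfl, hg.eps_pos.le⟩ s ⟨hs0, hs⟩ hs0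
  rw [hg.deriv_zero] at this
  linarith

end IsAdmissibleKernel

/-! ### A pulse dominated by its value at the origin -/

/-- The pulse `g - (κ / 2) (g (· - τ) + g (· + τ))`. -/
noncomputable def symPulse (g : ℝ → ℝ) (κ τ : ℝ) (t : ℝ) : ℝ :=
  g t + -(κ / 2) * (g (t + -τ) + g (t + τ))

lemma Pulse.symPulse {g g₁ g₂ : ℝ → ℝ} {B κ τ R : ℝ} (h : Pulse g g₁ g₂ B) (hκ : 0 ≤ κ)
    (hκ1 : κ ≤ 1) (hτ : |τ| ≤ R) :
    Pulse (symPulse g κ τ) (symPulse g₁ κ τ) (symPulse g₂ κ τ) (B + 2 * (1 + R ^ 2) * B) := by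
  have hB := h.nonneg
  refine (h.add (((h.shift (-τ)).add (h.shift τ)).const_mul (-(κ / 2)))).mono ?_
  have h1 : τ ^ 2 ≤ R ^ 2 := by
    rw [← sq_abs τ]; exact pow_le_pow_left₀ (abs_nonneg _) hτ 2
  rw [abs_neg, abs_of_nonneg (by positivity), neg_sq]
  have h2 : κ / 2 * (2 * (1 + τ ^ 2) * B + 2 * (1 + τ ^ 2) * B) = κ * (2 * (1 + τ ^ 2) * B) := by
    ring
  rw [h2]
  have h3 : κ * (2 * (1 + τ ^ 2) * B) ≤ 1 * (2 * (1 + R ^ 2) * B) := by gcongr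
  linarith

/-- Far from the origin an admissible kernel may be very negative, even below `-g 0`, so `g` alone
need not be dominated by its value at the origin. Let then `a` be the sample where `g` is minimal:
subtracting half of the two translates by `± a` raises the value at `0` by `|g (a / ω)|`, and since
`g (a / ω)` is the minimum, no other sample gains more, while `g ≤ g 0` bounds the resulting pulse
from below. -/
lemma exists_symPulse {g : ℝ → ℝ} {C : Fin 4 → ℝ} {ε β β₁ ω : ℝ} (hg : IsAdmissibleKernel g C ε β)
    (hβ : β < β₁) (h : ∀ t, |t| ≤ ε → iteratedDeriv 2 g t ≤ -β₁) (hω : 0 < ω) :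
    ∃ (κ : ℝ) (a : ℤ), 0 ≤ κ ∧ κ ≤ 1 ∧ (κ ≠ 0 → a ≠ 0) ∧ |(a : ℝ) / ω| ≤ 1 + 2 * C 0 / g 0 ∧
      g 0 ≤ symPulse g κ (a / ω) 0 ∧
      (∀ k : ℤ, symPulse g κ (a / ω) (k / ω) ≤ symPulse g κ (a / ω) 0 - (g 0 - g (k / ω))) ∧
      (∀ k : ℤ, -(symPulse g κ (a / ω) 0 - β₁ / 4 * ε ^ 2) ≤ symPulse g κ (a / ω) (k / ω)) := by
  have hg0 := hg.pos
  have hC0 := hg.const_pos 0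
  have hβ0 := hg.beta_pos
  have hε := hg.eps_pos
  have hroom : β₁ / 2 * ε ^ 2 ≤ g 0 := by
    have h1 := hg.le_sub_sq h (abs_of_pos hε).le
    have h2 := hg.pos_near ε (abs_of_pos hε).le
    linarith
  have hroom0 : 0 ≤ β₁ / 2 * ε ^ 2 := by
    have : 0 < β₁ := by linarith
    positivity
  by_cases hneg : ∃ k : ℤ, g (k / ω) < -(g 0 / 2)
  · set A : Set ℤ := {k : ℤ | g (k / ω) < -(g 0 / 2)}
    have hbd : ∀ k ∈ A, |(k : ℝ) / ω| ≤ 1 + 2 * C 0 / g 0 := by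
      intro k hk
      have h1 := hg.global_bound 0 ((k : ℝ) / ω)
      simp only [Fin.val_zero, iteratedDeriv_zero] at h1
      have h2 : g 0 / 2 < |g (k / ω)| := by
        rw [lt_abs]; right
        have : g (k / ω) < -(g 0 / 2) := hk
        linarith
      have h3 := h2.trans_le h1
      rw [lt_div_iff₀ (by positivity)] at h3
      have h4 : ((k : ℝ) / ω) ^ 2 ≤ 2 * C 0 / g 0 := by
        rw [le_div_iff₀ hg0]; nlinarith
      have h5 : 0 ≤ 2 * C 0 / g 0 := by positivity
      refine abs_le_of_sq_le_sq ?_ (by positivity)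
      nlinarith
    have hfin : A.Finite := by
      refine (Set.finite_Icc (-⌈(1 + 2 * C 0 / g 0) * ω⌉) ⌈(1 + 2 * C 0 / g 0) * ω⌉).subset ?_
      intro k hk
      have h1 := hbd k hk
      rw [abs_div, abs_of_pos hω, div_le_iff₀ hω] at h1
      have h2 := Int.le_ceil ((1 + 2 * C 0 / g 0) * ω)
      have h3 := abs_le.1 (h1.trans h2)
      constructor
      · exact_mod_cast h3.1
      · exact_mod_cast h3.2
    obtain ⟨a, haA, hamin⟩ := Set.exists_min_image A (fun k : ℤ => g (k / ω)) hfin hneg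
    have ha : g (a / ω) < -(g 0 / 2) := haA
    have hmin : ∀ k : ℤ, g (a / ω) ≤ g (k / ω) := by
      intro k
      by_cases hk : k ∈ A
      · exact hamin k hk
      · have : ¬ g (k / ω) < -(g 0 / 2) := hk
        linarith
    have hafar : ε < |(a : ℝ) / ω| := by
      by_contra hcon
      have := hg.pos_near _ (not_lt.1 hcon)
      linarith
    have h0 : symPulse g 1 (a / ω) 0 = g 0 - g (a / ω) := by
      simp only [symPulse, zero_add, hg.even]; ring
    refine ⟨1, a, zero_le_one, le_rfl, ?_, hbd a haA, ?_, ?_, ?_⟩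
    · rintro - rfl
      simp only [Int.cast_zero, zero_div, abs_zero] at hafar
      linarith
    · rw [h0]; linarith
    · intro k
      have h1 := hmin (k - a)
      have h2 := hmin (k + a)
      push_cast at h1 h2
      rw [sub_div] at h1
      rw [add_div] at h2
      rw [h0, symPulse, ← sub_eq_add_neg]
      linarith
    · intro k
      rw [h0, symPulse, ← sub_eq_add_neg]
      have h3 := hmin k
      -- one of the two translated arguments stays at distance `ε` from the origin
      have h4 : ε < |(k : ℝ) / ω - a / ω| ∨ ε < |(k : ℝ) / ω + a / ω| := by
        by_contra hcon
        push Not at hcon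
        have h5 := abs_sub ((k : ℝ) / ω + a / ω) ((k : ℝ) / ω - a / ω)
        have h6 : (k : ℝ) / ω + a / ω - ((k : ℝ) / ω - a / ω) = 2 * (a / ω) := by ring
        rw [h6, abs_mul, abs_two] at h5
        linarith [hcon.1, hcon.2]
      rcases h4 with h4 | h4
      · linarith [hg.le_sub_far h h4, hg.le_zero ((k : ℝ) / ω + a / ω)]
      · linarith [hg.le_sub_far h h4, hg.le_zero ((k : ℝ) / ω - a / ω)]
  · push Not at hneg
    have h0 : ∀ t, symPulse g 0 ((0 : ℤ) / ω) t = g t := by intro t; simp [symPulse]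
    have hR : 0 ≤ 2 * C 0 / g 0 := by positivity
    refine ⟨0, 0, le_rfl, zero_le_one, fun h => absurd rfl h, ?_, ?_, ?_, ?_⟩
    · simp only [Int.cast_zero, zero_div, abs_zero]; linarith
    · rw [h0]
    · intro k; rw [h0, h0]; linarith
    · intro k; rw [h0, h0]; linarith [hneg k]

/-- The odd pulse `g (· - τ) - g (· + τ)`. -/
noncomputable def oddPulse (g : ℝ → ℝ) (τ : ℝ) (t : ℝ) : ℝ :=
  g (t + -τ) + -1 * g (t + τ)

lemma Pulse.oddPulse {g g₁ g₂ : ℝ → ℝ} {B τ R : ℝ} (h : Pulse g g₁ g₂ B) (hτ : |τ| ≤ R) :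
    Pulse (oddPulse g τ) (oddPulse g₁ τ) (oddPulse g₂ τ) (4 * (1 + R ^ 2) * B) := by
  have hB := h.nonneg
  refine ((h.shift (-τ)).add ((h.shift τ).const_mul (-1))).mono ?_
  have h1 : τ ^ 2 ≤ R ^ 2 := by
    rw [← sq_abs τ]; exact pow_le_pow_left₀ (abs_nonneg _) hτ 2
  rw [abs_neg, abs_one, neg_sq]
  have h3 : 4 * (1 + τ ^ 2) * B ≤ 4 * (1 + R ^ 2) * B := by gcongr
  linarith

/-- When the sampling is fine, some integer shift `s` gives an odd pulse whose slope at the origin is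
bounded below. -/
lemma exists_oddPulse {g : ℝ → ℝ} {C : Fin 4 → ℝ} {ε β ω : ℝ} (hg : IsAdmissibleKernel g C ε β)
    (hω : 0 < ω) :
    ∃ (s : ℤ) (e : ℝ), |(s : ℝ) / ω| ≤ ε ∧ |e| ≤ 1 / (β * ε) ∧
      (e * oddPulse (deriv g) (s / ω) 0 = 1 ∨ ω * ε ≤ 2) := by
  have hβ := hg.beta_pos
  have hε := hg.eps_pos
  rcases le_or_gt (ω * ε) 2 with hsmall | hlarge
  · exact ⟨0, 0, by simpa using hε.le, by simpa using by positivity, Or.inr hsmall⟩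
  · have h1 := Int.le_ceil (ω * ε / 2)
    have h2 := Int.ceil_lt_add_one (ω * ε / 2)
    set s := ⌈ω * ε / 2⌉
    have h3 : ε / 2 ≤ (s : ℝ) / ω := by rw [le_div_iff₀ hω]; linarith
    have h4 : (s : ℝ) / ω ≤ ε := by rw [div_le_iff₀ hω]; linarith
    have h5 : β * ε ≤ oddPulse (deriv g) (s / ω) 0 := by
      have := hg.deriv_le_neg (by linarith) h4
      simp only [oddPulse, zero_add, hg.deriv_neg]
      nlinarith
    have h6 : 0 < β * ε := by positivity
    refine ⟨s, 1 / oddPulse (deriv g) (s / ω) 0, ?_, ?_, Or.inl ?_⟩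
    · rw [abs_of_nonneg (by linarith)]; exact h4
    · rw [abs_of_pos (one_div_pos.2 (h6.trans_le h5))]
      exact one_div_le_one_div_of_le h6 h5
    · exact one_div_mul_cancel (h6.trans_le h5).ne'

/-! ### Dual certificates -/

lemma tsum_shift_mul (α : ℤ → ℝ) (g : ℝ → ℝ) (ω : ℝ) (a k : ℤ) :
    ∑' j : ℤ, α (j - a) * g (((k : ℝ) - j) / ω)
      = ∑' j : ℤ, α j * g (((k : ℝ) - j) / ω + -((a : ℝ) / ω)) := by
  rw [← (Equiv.subRight a).tsum_eq fun j : ℤ => α j * g (((k : ℝ) - j) / ω + -((a : ℝ) / ω))]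
  refine tsum_congr fun j => ?_
  simp only [Equiv.subRight_apply]
  congr 2
  push_cast
  ring

/-- The coefficients of the convolution with `g` that represents `synth` for the pulses `symPulse`
and `oddPulse`. -/
noncomputable def dualCoeff (κ : ℝ) (a s : ℤ) (α b : ℤ → ℝ) (k : ℤ) : ℝ :=
  α k + -(κ / 2) * (α (k - a) + α (k - -a)) + (b (k - s) + -1 * b (k - -s))

lemma synth_eq_tsum_dualCoeff {g : ℝ → ℝ} {B ω : ℝ} (hω : 0 < ω)
    (hg : ∀ t, |g t| ≤ B / (1 + t ^ 2)) (κ : ℝ) (a s : ℤ) {α b : ℤ → ℝ} {U : ℝ}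
    (hα : ∀ j, |α j| ≤ U) (hb : ∀ j, |b j| ≤ U) (k : ℤ) :
    synth ω (symPulse g κ (a / ω)) (oddPulse g (s / ω)) α b k
      = ∑' j, dualCoeff κ a s α b j * g (((k : ℝ) - j) / ω) := by
  have hsh : ∀ {c : ℤ → ℝ}, (∀ j, |c j| ≤ U) → ∀ m : ℝ,
      Summable fun j : ℤ => c j * g (((k : ℝ) - j) / ω + m) := fun hc m =>
    summable_mul_decay hω (φ := fun t => g (t + m)) (fun t => decay_shift hg t m) hc k
  have hc0 : ∀ {c : ℤ → ℝ}, (∀ j, |c j| ≤ U) → ∀ m : ℤ,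
      Summable fun j : ℤ => c (j - m) * g (((k : ℝ) - j) / ω) := fun hc m =>
    summable_mul_decay hω hg (α := fun j => _) (fun j => hc (j - m)) k
  have hα0 := summable_mul_decay hω hg hα k
  have hleft : synth ω (symPulse g κ (a / ω)) (oddPulse g (s / ω)) α b k
      = ∑' j : ℤ, α j * g (((k : ℝ) - j) / ω)
        + -(κ / 2) * (∑' j : ℤ, α j * g (((k : ℝ) - j) / ω + -((a : ℝ) / ω))
          + ∑' j : ℤ, α j * g (((k : ℝ) - j) / ω + a / ω))
        + (∑' j : ℤ, b j * g (((k : ℝ) - j) / ω + -((s : ℝ) / ω))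
          + -1 * ∑' j : ℤ, b j * g (((k : ℝ) - j) / ω + s / ω)) := by
    rw [← (hsh hα _).tsum_add (hsh hα _), ← tsum_mul_left, ← tsum_mul_left,
      ← (hsh hb _).tsum_add ((hsh hb _).mul_left (-1)),
      ← hα0.tsum_add (((hsh hα _).add (hsh hα _)).mul_left _),
      ← (hα0.add (((hsh hα _).add (hsh hα _)).mul_left _)).tsum_add
        ((hsh hb _).add ((hsh hb _).mul_left (-1)))]
    refine tsum_congr fun j => ?_
    simp only [symPulse, oddPulse]
    ring
  have hneg : ∀ m : ℤ, (m : ℝ) / ω = -(((-m : ℤ) : ℝ) / ω) := by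
    intro m; push_cast; ring
  rw [hleft, ← tsum_shift_mul, ← tsum_shift_mul, hneg a, hneg s, ← tsum_shift_mul,
    ← tsum_shift_mul]
  rw [← (hc0 hα _).tsum_add (hc0 hα _), ← tsum_mul_left, ← tsum_mul_left,
      ← (hc0 hb _).tsum_add ((hc0 hb _).mul_left (-1)),
      ← hα0.tsum_add (((hc0 hα _).add (hc0 hα _)).mul_left _),
      ← (hα0.add (((hc0 hα _).add (hc0 hα _)).mul_left _)).tsum_add
        ((hc0 hb _).add ((hc0 hb _).mul_left (-1)))]
  refine tsum_congr fun j => ?_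
  simp only [dualCoeff]
  ring

/-- The point evaluations at `k ∈ K` and the corrections at `k ± a` do not overlap, so the
corrections do not increase the supremum norm. -/
lemma abs_dualCoeff_le {K : Set ℤ} {κ η : ℝ} (hκ0 : 0 ≤ κ) (hκ1 : κ ≤ 1) {a s : ℤ}
    (ha : κ ≠ 0 → ∀ k ∈ K, k - a ∉ K ∧ k - -a ∉ K) {α b : ℤ → ℝ} (hα : ∀ j, |α j| ≤ 1 + η)
    (hαK : ∀ j, j ∉ K → α j = 0) (hb : ∀ j, |b j| ≤ η) (k : ℤ) :
    |dualCoeff κ a s α b k| ≤ 1 + 3 * η := by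
  have hodd : |b (k - s) + -1 * b (k - -s)| ≤ 2 * η := by
    have h1 := abs_le.1 (hb (k - s))
    have h2 := abs_le.1 (hb (k - -s))
    exact abs_le.2 ⟨by linarith [h1.1, h2.2], by linarith [h1.2, h2.1]⟩
  have hsym : |α k + -(κ / 2) * (α (k - a) + α (k - -a))| ≤ 1 + η := by
    by_cases hκ : κ = 0
    · simpa [hκ] using hα k
    by_cases hk : k ∈ K
    · rw [hαK _ (ha hκ k hk).1, hαK _ (ha hκ k hk).2]
      simpa using hα k
    · rw [hαK k hk, zero_add, abs_mul, abs_neg, abs_of_nonneg (by positivity)]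
      have h1 : |α (k - a) + α (k - -a)| ≤ 2 * (1 + η) := by
        linarith [abs_add_le (α (k - a)) (α (k - -a)), hα (k - a), hα (k - -a)]
      calc κ / 2 * |α (k - a) + α (k - -a)| ≤ 1 / 2 * (2 * (1 + η)) := by gcongr
        _ = 1 + η := by ring
  unfold dualCoeff
  linarith [abs_add_le (α k + -(κ / 2) * (α (k - a) + α (k - -a)))
    (b (k - s) + -1 * b (k - -s))]

lemma exists_pos_forall_mul_le {A₁ A₂ A₃ A₄ b₁ b₂ b₃ b₄ : ℝ} (hb₁ : 0 < b₁) (hb₂ : 0 < b₂)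
    (hb₃ : 0 < b₃) (hb₄ : 0 < b₄) :
    ∃ η : ℝ, 0 < η ∧ η * A₁ ≤ b₁ ∧ η * A₂ ≤ b₂ ∧ η * A₃ ≤ b₃ ∧ η * A₄ ≤ b₄ := by
  have key : ∀ {A b : ℝ}, 0 < b → ∀ᶠ η : ℝ in nhdsWithin 0 (Set.Ioi 0), η * A ≤ b := by
    intro A b hb
    have : Filter.Tendsto (fun η : ℝ => η * A) (nhdsWithin 0 (Set.Ioi 0)) (nhds 0) := by
      have h : Filter.Tendsto (fun η : ℝ => η * A) (nhds 0) (nhds (0 * A)) :=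
        (continuous_mul_const A).tendsto 0
      rw [zero_mul] at h
      exact h.mono_left nhdsWithin_le_nhds
    exact this.eventually (ge_mem_nhds hb)
  obtain ⟨η, h⟩ := ((key (A := A₁) hb₁).and ((key (A := A₂) hb₂).and ((key (A := A₃) hb₃).and
    ((key (A := A₄) hb₄).and self_mem_nhdsWithin)))).exists
  exact ⟨η, h.2.2.2.2, h.1, h.2.1, h.2.2.1, h.2.2.2.1⟩

/-- The convolution of `f` with the kernel `g` sampled at scale `ω`. -/
noncomputable def corr (g : ℝ → ℝ) (ω : ℝ) (f : ℤ → ℝ) (k : ℤ) : ℝ :=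
  ∑' j : ℤ, f j * g (((k : ℝ) - j) / ω)

/-- `f` is a dual certificate of height `L` for the sign pattern `v` on `K`: its convolution with
the kernel sampled at scale `ω` interpolates `L v` on `K` and is smaller than `L` elsewhere. Up to the
scaled distance `ε` from `K` the gap grows quadratically, at rate at least `β' / 4` and at most `γ`. -/
structure IsCertificate (g : ℝ → ℝ) (ε β' γ ω L : ℝ) (K : Set ℤ) (v f : ℤ → ℝ) : Prop where
  abs_le_one : ∀ k, |f k| ≤ 1
  eq_on : ∀ i ∈ K, corr g ω f i = L * v i
  far : ∀ k : ℤ, (∀ i ∈ K, ε < |((k : ℝ) - i) / ω|) →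
    |corr g ω f k| ≤ L - β' / 4 * ε ^ 2
  near : ∀ k : ℤ, ∀ i ∈ K, |((k : ℝ) - i) / ω| ≤ ε →
    |corr g ω f k| ≤ L - β' / 4 * (((k : ℝ) - i) / ω) ^ 2
  lower : ∀ k : ℤ, ∀ i ∈ K, |((k : ℝ) - i) / ω| ≤ ε →
    L - γ * (((k : ℝ) - i) / ω) ^ 2 ≤ v i * corr g ω f k

lemma exists_nearest (K : Set ℤ) (hK : K.Nonempty) (k : ℤ) :
    ∃ i ∈ K, ∀ j ∈ K, |(k : ℝ) - i| ≤ |(k : ℝ) - j| := by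
  obtain ⟨i, hi, hmin⟩ := WellFounded.has_min
    (InvImage.wf (fun j : ℤ => (k - j).natAbs) Nat.lt_wfRel.wf) K hK
  refine ⟨i, hi, fun j hj => ?_⟩
  have h1 : (k - i).natAbs ≤ (k - j).natAbs := not_lt.1 (hmin j hj)
  have h2 : |k - i| ≤ |k - j| := by
    rw [Int.abs_eq_natAbs, Int.abs_eq_natAbs]; exact_mod_cast h1
  exact_mod_cast h2

/-- Behaviour near a point of `K` where the sign is `1`: `l` is the height of the pulse, `P` its value
at distance `t`, `A ≈ 1` its coefficient and `S` the value of the interpolant. -/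
lemma near_estimate {η β β' β₁ C₂ ε t l A P S : ℝ} (hη : 0 ≤ η) (hη1 : η ≤ 1) (hβ' : 0 ≤ β')
    (hβ : 0 ≤ β) (hβ₁ : 0 ≤ β₁) (hC₂ : 0 ≤ C₂) (hηβ : η * 4 ≤ β)
    (hηβ₁ : η * (β₁ / 2 + 1 + 3 * β' / 4) ≤ β₁ / 2 - β' / 4)
    (hgap : (1 + η) * (l - β₁ / 4 * ε ^ 2) + η ≤ l - (1 + 3 * η) * (β' / 4 * ε ^ 2))
    (hl : 0 ≤ l - β₁ / 4 * ε ^ 2) (ht : |t| ≤ ε) (hA : |A - 1| ≤ η)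
    (hS : |S - l - A * (P - l)| ≤ η * t ^ 2) (hS' : |S - A * P| ≤ η)
    (hup : P - l ≤ -(β₁ / 2 * t ^ 2)) (hlow : -(l - β₁ / 4 * ε ^ 2) ≤ P)
    (hsec : -(2 * C₂ * t ^ 2) ≤ P - l) :
    |S| ≤ l - (1 + 3 * η) * (β' / 4 * t ^ 2) ∧
      l - (1 + 3 * η) * ((2 * C₂ + β / 4) * t ^ 2) ≤ S := by
  have hA := abs_le.1 hA
  have hS := abs_le.1 hS
  have hS' := abs_le.1 hS'
  have ht2 : t ^ 2 ≤ ε ^ 2 := by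
    rw [← sq_abs t]; exact pow_le_pow_left₀ (abs_nonneg _) ht 2
  have ht0 : 0 ≤ t ^ 2 := sq_nonneg t
  have hPl : P - l ≤ 0 := hup.trans (neg_nonpos.2 (by positivity))
  have hA1 : A * (P - l) ≤ (1 - η) * (P - l) :=
    mul_le_mul_of_nonpos_right (by linarith) hPl
  have hA2 : (1 + η) * (P - l) ≤ A * (P - l) :=
    mul_le_mul_of_nonpos_right (by linarith) hPl
  refine ⟨abs_le.2 ⟨?_, ?_⟩, ?_⟩
  · have h3 : (1 + 3 * η) * (β' / 4 * t ^ 2) ≤ (1 + 3 * η) * (β' / 4 * ε ^ 2) := by gcongr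
    have h4 : -((1 + η) * (l - β₁ / 4 * ε ^ 2)) ≤ A * P := by
      rcases le_total 0 P with hP | hP
      · have : 0 ≤ A * P := mul_nonneg (by linarith) hP
        have : 0 ≤ (1 + η) * (l - β₁ / 4 * ε ^ 2) := by positivity
        linarith
      · have h5 : (1 + η) * P ≤ A * P := mul_le_mul_of_nonpos_right (by linarith) hP
        have h6 : (1 + η) * -(l - β₁ / 4 * ε ^ 2) ≤ (1 + η) * P := by gcongr
        linarith
    linarith
  · have h5 : (1 - η) * (P - l) ≤ (1 - η) * -(β₁ / 2 * t ^ 2) :=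
      mul_le_mul_of_nonneg_left hup (by linarith)
    have hb4 : η * (β₁ / 2 + 1 + 3 * β' / 4) * t ^ 2 ≤ (β₁ / 2 - β' / 4) * t ^ 2 :=
      mul_le_mul_of_nonneg_right hηβ₁ ht0
    linarith
  · have h5 : (1 + η) * -(2 * C₂ * t ^ 2) ≤ (1 + η) * (P - l) :=
      mul_le_mul_of_nonneg_left hsec (by linarith)
    have hbβ : η * 4 * t ^ 2 ≤ β * t ^ 2 := mul_le_mul_of_nonneg_right hηβ ht0
    have hηC : 0 ≤ η * (C₂ * t ^ 2) := by positivity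
    have hηβt : 0 ≤ η * (β * t ^ 2) := by positivity
    linarith

/-- For every sign pattern on a sufficiently separated set there is a dual certificate, with a height
`L` that does not depend on the pattern and is almost at least `g 0`. The gap constant `β'` exceeds
`β`, which later absorbs the losses from the interaction of distinct points. -/
lemma exists_certificate {g : ℝ → ℝ} {C : Fin 4 → ℝ} {ε β : ℝ} (hg : IsAdmissibleKernel g C ε β) :
    ∃ β', β < β' ∧ ∀ θ, 0 < θ → ∃ ν₀ : ℝ, 1 ≤ ν₀ ∧ ∀ ν, ν₀ ≤ ν → ∀ ω, 0 < ω →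
      ∃ L, g 0 ≤ (1 + θ) * L ∧ β' / 4 * ε ^ 2 ≤ L ∧
      ∀ K : Set ℤ, (∀ k ∈ K, ∀ j ∈ K, k ≠ j → ν * ω ≤ |(k : ℝ) - j|) →
      ∀ v : ℤ → ℝ, (∀ i ∈ K, v i = 1 ∨ v i = -1) →
      ∃ f, IsCertificate g ε β' (2 * C 2 + β / 4) ω L K v f := by
  obtain ⟨β₁, hβ₁, hconc⟩ := hg.exists_concave_room
  have hg0 := hg.pos
  have hβ := hg.beta_pos
  have hε := hg.eps_pos
  have hC0 := hg.const_pos 0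
  have hC1 := hg.const_pos 1
  have hC2 := hg.const_pos 2
  set β' := (β + β₁) / 2 with hβ'
  refine ⟨β', by linarith, fun θ hθ => ?_⟩
  set R : ℝ := 1 + 2 * C 0 / g 0 with hR
  have hR0 : 0 ≤ R := by positivity
  set B₀ : ℝ := C 0 + C 1 + C 2
  have hB₀ : 0 < B₀ := by positivity
  set B : ℝ := (B₀ + 2 * (1 + R ^ 2) * B₀) + 4 * (1 + ε ^ 2) * B₀ with hB
  have hB0 : 0 < B := by positivity
  obtain ⟨η, hη, hη1, hη2, hη3, hη4⟩ := exists_pos_forall_mul_le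
    (A₁ := 3) (b₁ := θ) (A₂ := 4) (b₂ := min β 1) (A₃ := B + 1 + 3 * β' / 4 * ε ^ 2)
    (b₃ := (β₁ - β') / 4 * ε ^ 2) (A₄ := β₁ / 2 + 1 + 3 * β' / 4) (b₄ := β₁ / 2 - β' / 4)
    hθ (lt_min hβ one_pos) (mul_pos (by linarith) (by positivity)) (by linarith)
  have hη2a := hη2.trans (min_le_left _ _)
  have hη2b := hη2.trans (min_le_right _ _)
  obtain ⟨ν₀, hν₀1, hν₀⟩ := exists_interpolation hB0.le hε hg0
    (show 0 ≤ 1 / (β * ε) by positivity) hη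
  refine ⟨max ν₀ (R + 1), hν₀1.trans (le_max_left _ _), fun ν hν ω hω => ?_⟩
  have hνR : R + 1 ≤ ν := (le_max_right _ _).trans hν
  obtain ⟨κ, a, hκ0, hκ1, hκa, haR, hp0, hpup, hplow⟩ := exists_symPulse hg hβ₁ hconc hω
  obtain ⟨s, e, hsε, he, hor⟩ := exists_oddPulse hg hω
  set p := symPulse g κ (a / ω) with hp
  have hpulse : Pulse p (symPulse (deriv g) κ (a / ω))
      (symPulse (iteratedDeriv 2 g) κ (a / ω)) B :=
    (hg.pulse.symPulse hκ0 hκ1 haR).mono (by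
      have : 0 ≤ 4 * (1 + ε ^ 2) * B₀ := by positivity
      linarith)
  have hopulse : Pulse (oddPulse g (s / ω)) (oddPulse (deriv g) (s / ω))
      (oddPulse (iteratedDeriv 2 g) (s / ω)) B :=
    (hg.pulse.oddPulse hsε).mono (by
      have : 0 ≤ B₀ + 2 * (1 + R ^ 2) * B₀ := by positivity
      linarith)
  have hsecond : ∀ t, -(2 * C 2 * t ^ 2) ≤ p t - p 0 := by
    intro t
    have h := abs_le.1 (abs_sub_linear_le hpulse.deriv₁ hpulse.deriv₂ (y := 0)
      (x := t) (M := 2 * C 2) (fun r _ => by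
        have b0 := hg.abs_deriv2_le (0 + r)
        have b1 := hg.abs_deriv2_le (0 + r + -((a : ℝ) / ω))
        have b2 := hg.abs_deriv2_le (0 + r + (a : ℝ) / ω)
        have b3 : |iteratedDeriv 2 g (0 + r + -((a : ℝ) / ω))
            + iteratedDeriv 2 g (0 + r + (a : ℝ) / ω)| ≤ 2 * C 2 :=
          (abs_add_le _ _).trans (by linarith)
        rw [symPulse]
        refine (abs_add_le _ _).trans ?_
        rw [abs_mul, abs_neg, abs_of_nonneg (by positivity : 0 ≤ κ / 2)]
        have b4 : κ / 2 * |iteratedDeriv 2 g (0 + r + -((a : ℝ) / ω))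
            + iteratedDeriv 2 g (0 + r + (a : ℝ) / ω)| ≤ 1 / 2 * (2 * C 2) := by gcongr
        linarith))
    have hd0 : symPulse (deriv g) κ (a / ω) 0 = 0 := by
      simp only [symPulse, zero_add, hg.deriv_neg, hg.deriv_zero]; ring
    rw [zero_add, hd0, zero_mul, sub_zero] at h
    exact h.1
  have ho0 : oddPulse g (s / ω) 0 = 0 := by
    simp only [oddPulse, zero_add, hg.even]; ring
  have hpB : p 0 ≤ B := (le_abs_self _).trans (hpulse.le_bound 0)
  have hroom : β₁ / 2 * ε ^ 2 ≤ g 0 := by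
    have h1 := hg.le_sub_sq hconc (abs_of_pos hε).le
    have h2 := hg.pos_near ε (abs_of_pos hε).le
    linarith
  have hε2 : 0 < ε ^ 2 := by positivity
  have hroom0 : 0 ≤ β₁ / 4 * ε ^ 2 := mul_nonneg (by linarith) hε2.le
  have hηpB : η * p 0 ≤ η * B := mul_le_mul_of_nonneg_left hpB hη.le
  have hηβ1 : 0 ≤ η * (β₁ / 4 * ε ^ 2) := mul_nonneg hη.le hroom0
  -- the perturbed gap away from `K`
  have hgap : (1 + η) * (p 0 - β₁ / 4 * ε ^ 2) + η ≤ p 0 - (1 + 3 * η) * (β' / 4 * ε ^ 2) := by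
    linarith
  have hgap0 : 0 ≤ (1 + η) * (p 0 - β₁ / 4 * ε ^ 2) + η := by
    have : 0 ≤ p 0 - β₁ / 4 * ε ^ 2 := by linarith
    positivity
  have hn : 0 < 1 + 3 * η := by positivity
  set L := p 0 / (1 + 3 * η) with hL
  have hLp : (1 + 3 * η) * L = p 0 := by rw [hL]; field_simp
  have hL0 : 0 ≤ L := div_nonneg (by linarith) hn.le
  refine ⟨L, ?_, ?_, ?_⟩
  · have : (1 + 3 * η) * L ≤ (1 + θ) * L := mul_le_mul_of_nonneg_right (by linarith) hL0
    linarith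
  · rw [hL, le_div_iff₀ hn]; linarith
  intro K hK v hv
  classical
  obtain ⟨α, b, hαK, hbK, hαv, hbη, hval, hnear, hfar⟩ := hν₀ ν ((le_max_left _ _).trans hν) ω hω K hK
    p _ _ _ _ _ hpulse hopulse ho0 hp0 e he hor (fun i => if i ∈ K then v i else 0)
    (fun i => by
      split_ifs with hi
      · rcases hv i hi with h | h <;> simp [h]
      · simp)
    (fun i hi => by simp [hi])
  have hαη : ∀ i, |α i| ≤ 1 + η := by
    intro i
    have h1 := hαv i
    split_ifs at h1 with hi
    · have h2 : |v i| = 1 := by rcases hv i hi with h | h <;> simp [h]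
      linarith [abs_sub_abs_le_abs_sub (α i) (v i)]
    · rw [hαK i hi]; simpa using by linarith
  have hbU : ∀ i, |b i| ≤ 1 + η := fun i => (hbη i).trans (by linarith)
  have hshift : κ ≠ 0 → ∀ k ∈ K, k - a ∉ K ∧ k - -a ∉ K := by
    intro hκ k hk
    have ha := hκa hκ
    have haω : |(a : ℝ)| ≤ R * ω := by
      rwa [abs_div, abs_of_pos hω, div_le_iff₀ hω] at haR
    have hlt : R * ω < ν * ω := mul_lt_mul_of_pos_right (by linarith) hω
    constructor
    · intro hmem
      have := hK k hk _ hmem (by omega)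
      push_cast at this
      rw [sub_sub_cancel] at this
      linarith
    · intro hmem
      have := hK k hk _ hmem (by omega)
      push_cast at this
      rw [sub_sub_cancel, abs_neg] at this
      linarith
  set F := dualCoeff κ a s α b with hF
  have hFb := abs_dualCoeff_le (s := s) hκ0 hκ1 hshift hαη hαK hbη
  have hq : ∀ k : ℤ, corr g ω (fun j => F j / (1 + 3 * η)) k
      = synth ω p (oddPulse g (s / ω)) α b k / (1 + 3 * η) := by
    intro k
    rw [corr, synth_eq_tsum_dualCoeff hω hg.pulse.bound₀ κ a s hαη hbU k, ← tsum_div_const]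
    exact tsum_congr fun j => by ring
  set S := synth ω p (oddPulse g (s / ω)) α b with hS
  have hsample : ∀ k i : ℤ, ((k : ℝ) - i) / ω = ((k - i : ℤ) : ℝ) / ω := by
    intro k i; push_cast; rfl
  -- the global bound for `S` at the points where the bump at `i` is the relevant one
  have hglobal : ∀ i ∈ K, ∀ k : ℤ,
      (|((k : ℝ) - i) / ω| ≤ ε ∨ ∀ j ∈ K, |(k : ℝ) - i| ≤ |(k : ℝ) - j|) → ∀ c, 0 ≤ c →
      |p (((k : ℝ) - i) / ω)| ≤ c → |S k| ≤ (1 + η) * c + η := by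
    intro i hi k hik c hc hpc
    have h1 := hfar i hi k hik
    have h2 : |α i * p (((k : ℝ) - i) / ω)| ≤ (1 + η) * c := by
      rw [abs_mul]; exact mul_le_mul (hαη i) hpc (abs_nonneg _) (by positivity)
    linarith [abs_sub_abs_le_abs_sub (S k) (α i * p (((k : ℝ) - i) / ω))]
  have hsign : ∀ i ∈ K, ∀ r : ℝ, |v i * r| = |r| := by
    intro i hi r
    rw [abs_mul]; rcases hv i hi with h | h <;> simp [h]
  have hnear' : ∀ k : ℤ, ∀ i ∈ K, |((k : ℝ) - i) / ω| ≤ ε →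
      |v i * S k| ≤ p 0 - (1 + 3 * η) * (β' / 4 * (((k : ℝ) - i) / ω) ^ 2) ∧
      p 0 - (1 + 3 * η) * ((2 * C 2 + β / 4) * (((k : ℝ) - i) / ω) ^ 2) ≤ v i * S k := by
    intro k i hi hk
    have hvv : v i * v i = 1 := by rcases hv i hi with h | h <;> simp [h]
    have h1 := hnear i hi k hk
    have h2 := hαv i
    simp only [if_pos hi] at h1 h2
    rw [← hsign i hi] at h1 h2
    rw [show v i * (S k - p 0 * v i - α i * (p (((k : ℝ) - i) / ω) - p 0))
      = v i * S k - p 0 * (v i * v i) - v i * α i * (p (((k : ℝ) - i) / ω) - p 0) by ring, hvv,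
      mul_one] at h1
    rw [mul_sub, hvv] at h2
    have h3 := hfar i hi k (Or.inl hk)
    rw [← hsign i hi, mul_sub, ← mul_assoc] at h3
    have hup := hpup (k - i)
    have hlow := hplow (k - i)
    rw [← hsample] at hup hlow
    have hquad := hg.le_sub_sq hconc hk
    exact near_estimate hη.le (by linarith) (by linarith) hβ.le (by linarith) hC2.le hη2a hη4
      (by linarith) (by linarith) hk h2 h1 h3 (by linarith) hlow (hsecond (((k : ℝ) - i) / ω))
  refine ⟨fun k => F k / (1 + 3 * η), ?_, ?_, ?_, ?_, ?_⟩
  · intro k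
    rw [abs_div, abs_of_pos hn, div_le_one hn]
    exact hFb k
  · intro i hi
    rw [hq, hval i hi, if_pos hi, hL]; ring
  · intro k hk
    rw [hq, abs_div, abs_of_pos hn, div_le_iff₀ hn]
    have hgoal : |S k| ≤ p 0 - (1 + 3 * η) * (β' / 4 * ε ^ 2) := by
      rcases K.eq_empty_or_nonempty with hKe | hKne
      · have : S k = 0 := by
          have h0 : ∀ j, α j = 0 := fun j => hαK j (by simp [hKe])
          have h1 : ∀ j, b j = 0 := fun j => hbK j (by simp [hKe])
          simp [hS, synth, h0, h1]
        rw [this, abs_zero]; linarith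
      · obtain ⟨i, hi, hmin⟩ := exists_nearest K hKne k
        have hup := hpup (k - i)
        have hlow := hplow (k - i)
        rw [← hsample] at hup hlow
        have hf := hg.le_sub_far hconc (hk i hi)
        have := hglobal i hi k (Or.inr hmin) (p 0 - β₁ / 4 * ε ^ 2) (by linarith)
          (abs_le.2 ⟨by linarith, by linarith⟩)
        linarith
    linarith
  · intro k i hi hk
    obtain ⟨h1, -⟩ := hnear' k i hi hk
    rw [hq, abs_div, abs_of_pos hn, div_le_iff₀ hn]
    rw [hsign i hi] at h1
    linarith
  · intro k i hi hk
    obtain ⟨-, h1⟩ := hnear' k i hi hk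
    rw [hq, ← mul_div_assoc, le_div_iff₀ hn]
    linarith

/-! ### Sequences with finite `ℓ¹` norm -/

lemma l1Norm_eq_ofReal {f : ℤ → ℝ} (hf : Summable fun k => |f k|) :
    l1Norm f = ENNReal.ofReal (∑' k, |f k|) := by
  rw [ENNReal.ofReal_tsum_of_nonneg (fun k => abs_nonneg _) hf]
  exact tsum_congr fun k => by rw [Real.enorm_eq_ofReal_abs]

lemma summable_abs_of_l1Norm_lt_top {f : ℤ → ℝ} (hf : l1Norm f < ⊤) :
    Summable fun k => |f k| := by
  have h : ∑' k, ((‖f k‖₊ : NNReal) : ℝ≥0∞) ≠ ⊤ := hf.ne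
  have := ENNReal.tsum_coe_ne_top_iff_summable.1 h
  exact NNReal.summable_coe.2 this

lemma tsum_abs_le_of_l1Norm_le {f : ℤ → ℝ} {δ : ℝ} (hδ : 0 ≤ δ)
    (hf : l1Norm f ≤ ENNReal.ofReal δ) :
    (Summable fun k => |f k|) ∧ ∑' k, |f k| ≤ δ := by
  have hs := summable_abs_of_l1Norm_lt_top (hf.trans_lt ENNReal.ofReal_lt_top)
  rw [l1Norm_eq_ofReal hs] at hf
  exact ⟨hs, (ENNReal.ofReal_le_ofReal_iff hδ).1 hf⟩

lemma sampledKernel_eq (g : ℝ → ℝ) (N σ : ℝ) (k : ℤ) :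
    sampledKernel g N σ k = g (k / (N * σ)) := by
  rw [sampledKernel, div_div, mul_comm]

/-- The kernel being even, convolution with it is symmetric for the pairing of bounded and summable
sequences. -/
lemma tsum_mul_conv {g : ℝ → ℝ} {B ω : ℝ} (hω : 0 < ω) (heven : ∀ t, g (-t) = g t)
    (hg : ∀ t, |g t| ≤ B / (1 + t ^ 2)) {f h : ℤ → ℝ} (hf : ∀ k, |f k| ≤ 1)
    (hh : Summable fun k => |h k|) :
    ∑' k, f k * conv (fun k => g (k / ω)) h k = ∑' k, h k * corr g ω f k := by
  have hs : Summable (Function.uncurry fun k j : ℤ => f k * (g (((k - j : ℤ) : ℝ) / ω) * h j)) := by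
    have h1 : Summable fun m : ℤ => |g ((m : ℝ) / ω)| := by
      have := (summable_mul_decay hω hg (α := fun _ => 1) (U := 1) (by simp) 0).abs
      simpa [heven, neg_div] using this
    have h2 := h1.mul_of_nonneg hh (fun _ => abs_nonneg _) (fun _ => abs_nonneg _)
    have hinj : Function.Injective fun x : ℤ × ℤ => (x.1 - x.2, x.2) := by
      rintro ⟨a, b⟩ ⟨c, d⟩ hab
      simp only [Prod.mk.injEq] at hab ⊢
      omega
    refine Summable.of_norm_bounded (h2.comp_injective hinj) ?_
    rintro ⟨k, j⟩
    simp only [Function.uncurry, Function.comp, Real.norm_eq_abs, abs_mul]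
    exact mul_le_of_le_one_left (by positivity) (hf k)
  have h3 := hs.tsum_comm
  simp only [conv, corr]
  calc ∑' k, f k * ∑' j : ℤ, g (((k - j : ℤ) : ℝ) / ω) * h j
      = ∑' k, ∑' j, f k * (g (((k - j : ℤ) : ℝ) / ω) * h j) := by
        exact tsum_congr fun k => tsum_mul_left.symm
    _ = ∑' j, ∑' k, f k * (g (((k - j : ℤ) : ℝ) / ω) * h j) := h3.symm
    _ = ∑' j, h j * ∑' k : ℤ, f k * g (((j : ℝ) - k) / ω) := by
        refine tsum_congr fun j => ?_
        rw [← tsum_mul_left]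
        refine tsum_congr fun k => ?_
        rw [← heven]
        push_cast
        rw [← neg_div, neg_sub]
        ring

lemma abs_tsum_mul_le {f z : ℤ → ℝ} {S : ℝ} (hf : ∀ k, |f k| ≤ 1) (hz : Summable fun k => |z k|)
    (hS : ∑' k, |z k| ≤ S) : |∑' k, f k * z k| ≤ S := by
  have := tsum_of_norm_bounded hz.hasSum (f := fun k => f k * z k) fun k => by
    rw [norm_mul]; exact mul_le_of_le_one_left (abs_nonneg _) (hf k)
  exact this.trans hS

lemma conv_sub {a x z : ℤ → ℝ} {B : ℝ} (ha : ∀ k, |a k| ≤ B) (hx : Summable fun k => |x k|)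
    (hz : Summable fun k => |z k|) (k : ℤ) :
    conv a (fun k => z k - x k) k = conv a z k - conv a x k := by
  have hs : ∀ {u : ℤ → ℝ}, (Summable fun k => |u k|) → Summable fun j => a (k - j) * u j :=
    fun hu => Summable.of_norm_bounded (hu.mul_left B) fun j => by
      rw [norm_mul]; exact mul_le_mul_of_nonneg_right (ha _) (abs_nonneg _)
  simp only [conv]
  rw [← (hs hz).tsum_sub (hs hx)]
  exact tsum_congr fun j => by ring

/-! ### Error estimates from dual certificates -/

namespace IsCertificate

variable {g : ℝ → ℝ} {ε β' γ ω L : ℝ} {K : Set ℤ} {v f : ℤ → ℝ}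

lemma abs_corr_le (hc : IsCertificate g ε β' γ ω L K v f) (hβ' : 0 ≤ β') (k : ℤ) :
    |corr g ω f k| ≤ L := by
  by_cases h : ∃ i ∈ K, |((k : ℝ) - i) / ω| ≤ ε
  · obtain ⟨i, hi, hik⟩ := h
    have := hc.near k i hi hik
    have : 0 ≤ β' / 4 * (((k : ℝ) - i) / ω) ^ 2 := by positivity
    linarith
  · push Not at h
    have := hc.far k h
    have : 0 ≤ β' / 4 * ε ^ 2 := by positivity
    linarith

lemma gap_of_le (hc : IsCertificate g ε β' γ ω L K v f) {w : ℝ} (hwε : w ≤ β' / 4 * ε ^ 2) {k : ℤ}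
    (hk : ∀ i ∈ K, |((k : ℝ) - i) / ω| ≤ ε → w ≤ β' / 4 * (((k : ℝ) - i) / ω) ^ 2) :
    w ≤ L - |corr g ω f k| := by
  by_cases h : ∃ i ∈ K, |((k : ℝ) - i) / ω| ≤ ε
  · obtain ⟨i, hi, hik⟩ := h
    linarith [hc.near k i hi hik, hk i hi hik]
  · push Not at h
    linarith [hc.far k h]

end IsCertificate

section Error

variable {g : ℝ → ℝ} {ε β' γ ω L δ : ℝ} {x z f : ℤ → ℝ} {v : ℤ → ℝ}

lemma summable_mul_corr (hc : IsCertificate g ε β' γ ω L (Function.support x) v f) (hβ' : 0 ≤ β')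
    {h : ℤ → ℝ} (hh : Summable fun k => |h k|) : Summable fun k => h k * corr g ω f k :=
  Summable.of_norm_bounded (hh.mul_right L) fun k => by
    rw [norm_mul]
    exact mul_le_mul_of_nonneg_left (hc.abs_corr_le hβ' k) (abs_nonneg _)

/-- On the support of `x`, a certificate for the signs of the error `z - x` pairs with the error to
its full mass. -/
lemma mul_corr_eq (hc : IsCertificate g ε β' γ ω L (Function.support x)
      (fun k => if 0 ≤ z k - x k then 1 else -1) f) {k : ℤ} (hk : k ∈ Function.support x) :
    (z k - x k) * corr g ω f k = L * |z k - x k| := by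
  rw [hc.eq_on k hk]
  split_ifs with h
  · rw [abs_of_nonneg h]; ring
  · rw [abs_of_neg (not_le.1 h)]; ring

open Classical in
/-- The mass of the solution off the support of `x`, weighted by the gap of the certificate. -/
noncomputable def gapMass (g : ℝ → ℝ) (ω L : ℝ) (x z f : ℤ → ℝ) (k : ℤ) : ℝ :=
  if k ∈ Function.support x then 0 else (L - |corr g ω f k|) * |z k|

lemma gapMass_nonneg (hc : IsCertificate g ε β' γ ω L (Function.support x) v f) (hβ' : 0 ≤ β')
    (k : ℤ) : 0 ≤ gapMass g ω L x z f k := by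
  unfold gapMass
  split_ifs
  · exact le_rfl
  · exact mul_nonneg (by linarith [hc.abs_corr_le hβ' k]) (abs_nonneg _)

/-- The pairing of the certificate with the error is at most `2 δ`, while minimality of `‖z‖₁` makes
the mass gained off the support at most the mass lost on it. -/
lemma tsum_gapMass_le (hc : IsCertificate g ε β' γ ω L (Function.support x)
      (fun k => if 0 ≤ z k - x k then 1 else -1) f) (hβ' : 0 ≤ β') (hL : 0 ≤ L)
    (hx : Summable fun k => |x k|) (hz : Summable fun k => |z k|)
    (hzx : ∑' k, |z k| ≤ ∑' k, |x k|)
    (hpair : |∑' k, (z k - x k) * corr g ω f k| ≤ 2 * δ) :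
    Summable (gapMass g ω L x z f) ∧ ∑' k, gapMass g ω L x z f k ≤ 2 * δ := by
  have hh : Summable fun k => |z k - x k| :=
    (hz.add hx).of_nonneg_of_le (fun _ => abs_nonneg _) fun k => abs_sub _ _
  have hq := summable_mul_corr hc hβ' hh
  have hs := hq.add ((hz.sub hx).mul_left L)
  have hpt : ∀ k, gapMass g ω L x z f k
      ≤ (z k - x k) * corr g ω f k + L * (|z k| - |x k|) := by
    intro k
    unfold gapMass
    split_ifs with hk
    · rw [mul_corr_eq hc hk]
      have h1 := abs_sub_abs_le_abs_sub (x k) (z k)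
      rw [abs_sub_comm] at h1
      nlinarith
    · have hxk : x k = 0 := by simpa using hk
      rw [hxk, sub_zero, abs_zero, sub_zero]
      have h1 := neg_abs_le (z k * corr g ω f k)
      rw [abs_mul] at h1
      linarith
  refine ⟨hs.of_nonneg_of_le (gapMass_nonneg hc hβ') hpt, ?_⟩
  refine ((hs.of_nonneg_of_le (gapMass_nonneg hc hβ') hpt).tsum_le_tsum hpt hs).trans ?_
  rw [hq.tsum_add ((hz.sub hx).mul_left L), tsum_mul_left, hz.tsum_sub hx]
  have h1 := mul_nonneg hL (sub_nonneg.2 hzx)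
  linarith [le_abs_self (∑' k, (z k - x k) * corr g ω f k)]

lemma mul_tsum_abs_sub_le (hc : IsCertificate g ε β' γ ω L (Function.support x)
      (fun k => if 0 ≤ z k - x k then 1 else -1) f) (hβ' : 0 ≤ β')
    (hx : Summable fun k => |x k|) (hz : Summable fun k => |z k|)
    (hzx : ∑' k, |z k| ≤ ∑' k, |x k|)
    (hpair : |∑' k, (z k - x k) * corr g ω f k| ≤ 2 * δ) {w : ℝ} (hw0 : 0 ≤ w) (hwL : w ≤ L)
    (hw : ∀ k, k ∉ Function.support x → w ≤ L - |corr g ω f k|) :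
    w * ∑' k, |z k - x k| ≤ 4 * δ := by
  have hh : Summable fun k => |z k - x k| :=
    (hz.add hx).of_nonneg_of_le (fun _ => abs_nonneg _) fun k => abs_sub _ _
  have hq := summable_mul_corr hc hβ' hh
  have hs := (hq.mul_left 2).add ((hz.sub hx).mul_left (2 * L - w))
  have hpt : ∀ k, w * |z k - x k|
      ≤ 2 * ((z k - x k) * corr g ω f k) + (2 * L - w) * (|z k| - |x k|) := by
    intro k
    by_cases hk : k ∈ Function.support x
    · rw [mul_corr_eq hc hk]
      have h1 := abs_sub_abs_le_abs_sub (x k) (z k)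
      rw [abs_sub_comm] at h1
      nlinarith
    · have hxk : x k = 0 := by simpa using hk
      rw [hxk, sub_zero, abs_zero, sub_zero]
      have h1 := neg_abs_le (z k * corr g ω f k)
      rw [abs_mul] at h1
      nlinarith [hw k hk, abs_nonneg (z k)]
  rw [← tsum_mul_left]
  refine ((hh.mul_left w).tsum_le_tsum hpt hs).trans ?_
  rw [(hq.mul_left 2).tsum_add ((hz.sub hx).mul_left _), tsum_mul_left, tsum_mul_left,
    hz.tsum_sub hx]
  have h1 := mul_nonneg (by linarith : 0 ≤ 2 * L - w) (sub_nonneg.2 hzx)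
  linarith [le_abs_self (∑' k, (z k - x k) * corr g ω f k)]

/-- If the solution vanishes, then the amplitudes are below the noise level. -/
lemma amplitude_le_of_eq_zero (hc : IsCertificate g ε β' γ ω L (Function.support x)
      (fun k => if 0 ≤ z k - x k then 1 else -1) f) (hβ' : 0 ≤ β') (hL : 0 ≤ L)
    (hx : Summable fun k => |x k|) (hz0 : ∀ k, z k = 0)
    (hpair : |∑' k, (z k - x k) * corr g ω f k| ≤ 2 * δ) (m : ℤ) : L * |x m| ≤ 2 * δ := by
  have hh : Summable fun k => |z k - x k| := by
    simpa [hz0] using hx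
  have hq := summable_mul_corr hc hβ' hh
  have hpt : ∀ k, (z k - x k) * corr g ω f k = L * |x k| := by
    intro k
    by_cases hk : k ∈ Function.support x
    · rw [mul_corr_eq hc hk, hz0, zero_sub, abs_neg]
    · have hxk : x k = 0 := by simpa using hk
      simp [hxk, hz0]
  rw [tsum_congr hpt] at hpair
  have h1 := (hx.mul_left L).le_tsum m fun k _ => by positivity
  linarith [le_abs_self (∑' k, L * |x k|)]

/-- Half the sum of the certificates for the constant sign pattern and for the pattern that is `1`
at `m` only vanishes to second order on the rest of the support. Tested against it, an error with no
mass within distance `ρ` of `m` gives a bound for the amplitude at `m`. -/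
lemma amplitude_le_of_isolated {f₁ f₂ : ℤ → ℝ} {m : ℤ} {ρ Γ : ℝ}
    (hc : IsCertificate g ε β' γ ω L (Function.support x)
      (fun k => if 0 ≤ z k - x k then 1 else -1) f)
    (hc₁ : IsCertificate g ε β' γ ω L (Function.support x) (fun _ => 1) f₁)
    (hc₂ : IsCertificate g ε β' γ ω L (Function.support x) (fun k => if k = m then 1 else -1) f₂)
    (hβ' : 0 ≤ β') (hL : 0 ≤ L)
    (hx : Summable fun k => |x k|) (hz : Summable fun k => |z k|)
    (hzx : ∑' k, |z k| ≤ ∑' k, |x k|)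
    (hpair : |∑' k, (z k - x k) * corr g ω f k| ≤ 2 * δ)
    (hpair₁ : |∑' k, (z k - x k) * corr g ω f₁ k| ≤ 2 * δ)
    (hpair₂ : |∑' k, (z k - x k) * corr g ω f₂ k| ≤ 2 * δ)
    (hm : m ∈ Function.support x) (hzm : z m = 0) (hρ : 0 ≤ ρ)
    (hiso : ∀ k, z k ≠ 0 → ρ ≤ |((k : ℝ) - m) / ω|) (hΓ : 0 ≤ Γ)
    (hΓρ : L ≤ Γ * (β' / 4 * ρ ^ 2)) (hΓε : L ≤ Γ * (β' / 4 * ε ^ 2))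
    (hΓγ : γ / 2 ≤ Γ * (β' / 4)) : L * |x m| ≤ 2 * δ + Γ * (2 * δ) := by
  classical
  have hh : Summable fun k => |z k - x k| :=
    (hz.add hx).of_nonneg_of_le (fun _ => abs_nonneg _) fun k => abs_sub _ _
  obtain ⟨hgs, hgap⟩ := tsum_gapMass_le hc hβ' hL hx hz hzx hpair
  have hq₁ := summable_mul_corr hc₁ hβ' hh
  have hq₂ := summable_mul_corr hc₂ hβ' hh
  set σ : ℝ := if 0 ≤ x m then 1 else -1 with hσ
  have hσ1 : |σ| = 1 := by rw [hσ]; split_ifs <;> simp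
  have hσx : σ * x m = |x m| := by
    rw [hσ]; split_ifs with h
    · rw [abs_of_nonneg h, one_mul]
    · rw [abs_of_neg (not_le.1 h)]; ring
  set Y : ℤ → ℝ := fun k =>
    -(σ / 2) * ((z k - x k) * corr g ω f₁ k + (z k - x k) * corr g ω f₂ k) with hY
  have hYs : Summable Y := (hq₁.add hq₂).mul_left _
  have hpt : ∀ k, (if k = m then L * |x m| else 0) ≤ Y k + Γ * gapMass g ω L x z f k := by
    intro k
    have h₁ := hc₁.abs_corr_le hβ' k
    have h₂ := hc₂.abs_corr_le hβ' k
    by_cases hk : k ∈ Function.support x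
    · simp only [hY, gapMass, if_pos hk, hc₁.eq_on k hk, hc₂.eq_on k hk]
      split_ifs with hkm
      · subst hkm
        rw [hzm]
        linarith [congrArg (L * ·) hσx]
      · linarith
    · have hkm : k ≠ m := fun h => hk (h ▸ hm)
      have hxk : x k = 0 := by simpa using hk
      simp only [hY, gapMass, if_neg hk, if_neg hkm, hxk, sub_zero]
      by_cases hzk : z k = 0
      · simp [hzk]
      have havg : |corr g ω f₁ k + corr g ω f₂ k| / 2 ≤ Γ * (L - |corr g ω f k|) := by
        by_cases hnear : ∃ i ∈ Function.support x, |((k : ℝ) - i) / ω| ≤ ε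
        · obtain ⟨i, hi, hik⟩ := hnear
          have hgapi := hc.near k i hi hik
          by_cases him : i = m
          · subst him
            have h3 : ρ ^ 2 ≤ (((k : ℝ) - i) / ω) ^ 2 := by
              rw [← sq_abs (((k : ℝ) - i) / ω)]
              exact pow_le_pow_left₀ hρ (hiso k hzk) 2
            have h4 : Γ * (β' / 4 * ρ ^ 2) ≤ Γ * (L - |corr g ω f k|) := by
              refine mul_le_mul_of_nonneg_left ?_ hΓ
              have := mul_le_mul_of_nonneg_left h3 (by positivity : 0 ≤ β' / 4)
              linarith
            linarith [abs_add_le (corr g ω f₁ k) (corr g ω f₂ k)]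
          · have h3 := hc₁.lower k i hi hik
            have h4 := hc₂.lower k i hi hik
            simp only [if_neg him] at h4
            have h5 := abs_le.1 h₁
            have h6 := abs_le.1 h₂
            have h7 : |corr g ω f₁ k + corr g ω f₂ k| ≤ γ * (((k : ℝ) - i) / ω) ^ 2 :=
              abs_le.2 ⟨by linarith, by linarith⟩
            have h8 : Γ * (β' / 4 * (((k : ℝ) - i) / ω) ^ 2) ≤ Γ * (L - |corr g ω f k|) :=
              mul_le_mul_of_nonneg_left (by linarith) hΓ
            have h9 : γ / 2 * (((k : ℝ) - i) / ω) ^ 2 ≤ Γ * (β' / 4) * (((k : ℝ) - i) / ω) ^ 2 :=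
              mul_le_mul_of_nonneg_right hΓγ (sq_nonneg _)
            linarith
        · push Not at hnear
          have h3 := hc.far k hnear
          have h4 : Γ * (β' / 4 * ε ^ 2) ≤ Γ * (L - |corr g ω f k|) :=
            mul_le_mul_of_nonneg_left (by linarith) hΓ
          linarith [abs_add_le (corr g ω f₁ k) (corr g ω f₂ k)]
      have habs : |σ / 2 * (z k * corr g ω f₁ k + z k * corr g ω f₂ k)|
          ≤ Γ * ((L - |corr g ω f k|) * |z k|) := by
        rw [← mul_add, abs_mul, abs_mul, abs_div, hσ1, abs_two]
        calc _ = |corr g ω f₁ k + corr g ω f₂ k| / 2 * |z k| := by ring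
          _ ≤ Γ * (L - |corr g ω f k|) * |z k| :=
            mul_le_mul_of_nonneg_right havg (abs_nonneg _)
          _ = _ := by ring
      linarith [le_abs_self (σ / 2 * (z k * corr g ω f₁ k + z k * corr g ω f₂ k))]
  have hsum := (hasSum_ite_eq m (L * |x m|)).summable.tsum_le_tsum hpt (hYs.add (hgs.mul_left Γ))
  rw [tsum_ite_eq, hYs.tsum_add (hgs.mul_left Γ), tsum_mul_left (a := Γ)] at hsum
  have hYle : ∑' k, Y k ≤ 2 * δ := by
    simp only [hY]
    rw [tsum_mul_left, hq₁.tsum_add hq₂]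
    refine (le_abs_self _).trans ?_
    rw [abs_mul, abs_neg, abs_div, hσ1, abs_two]
    linarith [abs_add_le (∑' k, (z k - x k) * corr g ω f₁ k)
      (∑' k, (z k - x k) * corr g ω f₂ k)]
  linarith [mul_le_mul_of_nonneg_left hgap hΓ]

end Error

/-! ### Solutions of the convex program and constants -/

/-- The error of a solution has small convolution with the kernel, hence small pairing with the
convolution of the kernel with any sequence bounded by `1`. -/
lemma abs_tsum_error_mul_corr_le {g : ℝ → ℝ} {B N σ δ : ℝ} (hω : 0 < N * σ)
    (heven : ∀ t, g (-t) = g t) (hg : ∀ t, |g t| ≤ B / (1 + t ^ 2)) (hδ : 0 ≤ δ)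
    {x n y z : ℤ → ℝ} (hx : l1Norm x < ⊤) (hn : l1Norm n ≤ ENNReal.ofReal δ)
    (hy : ∀ k : ℤ, y k = conv (sampledKernel g N σ) x k + n k)
    (hz : IsSolution (sampledKernel g N σ) y δ z) :
    (Summable fun k => |x k|) ∧ (Summable fun k => |z k|) ∧ ∑' k, |z k| ≤ ∑' k, |x k| ∧
      ∀ f : ℤ → ℝ, (∀ k, |f k| ≤ 1) →
        |∑' k, (z k - x k) * corr g (N * σ) f k| ≤ 2 * δ := by
  have hxs := summable_abs_of_l1Norm_lt_top hx
  have hxfeas : IsFeasible (sampledKernel g N σ) y δ x := by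
    have : (fun k => y k - conv (sampledKernel g N σ) x k) = n := by
      funext k; rw [hy]; ring
    rw [IsFeasible, this]
    exact hn
  have hzx := hz.2 x hxfeas
  have hzs := summable_abs_of_l1Norm_lt_top (hzx.trans_lt hx)
  rw [l1Norm_eq_ofReal hzs, l1Norm_eq_ofReal hxs,
    ENNReal.ofReal_le_ofReal_iff (tsum_nonneg fun _ => abs_nonneg _)] at hzx
  refine ⟨hxs, hzs, hzx, fun f hf => ?_⟩
  obtain ⟨hns, hnδ⟩ := tsum_abs_le_of_l1Norm_le hδ hn
  obtain ⟨hrs, hrδ⟩ := tsum_abs_le_of_l1Norm_le hδ hz.1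
  have hB : ∀ k, |sampledKernel g N σ k| ≤ B := fun k => by
    have hB0 : 0 ≤ B := by simpa using (abs_nonneg _).trans (hg 0)
    exact (hg _).trans (div_le_self hB0 (by nlinarith [sq_nonneg ((k : ℝ) / σ / N)]))
  have hconv : ∀ k, conv (sampledKernel g N σ) (fun k => z k - x k) k
      = n k - (y k - conv (sampledKernel g N σ) z k) := by
    intro k
    rw [conv_sub hB hxs hzs, hy]; ring
  have hle : ∀ k, |conv (sampledKernel g N σ) (fun k => z k - x k) k|
      ≤ |n k| + |y k - conv (sampledKernel g N σ) z k| := by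
    intro k
    rw [hconv]; exact abs_sub _ _
  have hcs := (hns.add hrs).of_nonneg_of_le (fun _ => abs_nonneg _) hle
  have hcδ := hcs.tsum_le_tsum hle (hns.add hrs)
  rw [hns.tsum_add hrs] at hcδ
  have hkernel : sampledKernel g N σ = fun k : ℤ => g (k / (N * σ)) :=
    funext fun k => sampledKernel_eq g N σ k
  have hh : Summable fun k => |z k - x k| :=
    (hzs.add hxs).of_nonneg_of_le (fun _ => abs_nonneg _) fun k => abs_sub _ _
  rw [← tsum_mul_conv hω heven hg hf hh, ← hkernel]
  exact abs_tsum_mul_le hf hcs (by linarith)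

lemma exists_forall_one_div_le_D2 {g : ℝ → ℝ} {C : Fin 4 → ℝ} {ε β : ℝ}
    (hg : IsAdmissibleKernel g C ε β) :
    ∃ ν₁ : ℝ, ∀ ν, ν₁ ≤ ν → ∀ N σ : ℝ, 1 / g 0 ≤ D2 g C ε β ν N σ := by
  have hg0 := hg.pos
  have hβ := hg.beta_pos
  have hC0 := hg.const_pos 0
  have hC2 := hg.const_pos 2
  have hG : 0 < |iteratedDeriv 2 g 0| := by
    have := hg.concave_near 0 (by simpa using hg.eps_pos.le)
    exact abs_pos.2 (by linarith)
  refine ⟨1 + Real.pi ^ 2 * C 2 / (3 * |iteratedDeriv 2 g 0|)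
    + 2 * Real.pi ^ 2 * C 0 / (3 * g 0), fun ν hν N σ => ?_⟩
  set G := |iteratedDeriv 2 g 0|
  have h1 : 0 ≤ Real.pi ^ 2 * C 2 / (3 * G) := by positivity
  have h2 : 0 ≤ 2 * Real.pi ^ 2 * C 0 / (3 * g 0) := by positivity
  have hν1 : 1 ≤ ν := by linarith
  have hνsq : ν ≤ ν ^ 2 := by nlinarith
  have h3 : Real.pi ^ 2 * C 2 / (3 * G) < ν ^ 2 := by linarith
  have h4 : 2 * Real.pi ^ 2 * C 0 / (3 * g 0) < ν ^ 2 := by linarith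
  rw [div_lt_iff₀ (by positivity)] at h3 h4
  have hX : 0 < 3 * G * ν ^ 2 - Real.pi ^ 2 * C 2 := by linarith
  have hZ : 0 < 3 * g 0 * ν ^ 2 - 2 * Real.pi ^ 2 * C 0 := by linarith
  unfold D2
  rw [div_le_div_iff₀ hg0 (mul_pos hX hZ)]
  have hY : 0 ≤ 16 * C 1 ^ 2 * gam N σ ε ^ 2 * Real.pi ^ 2 / β
      * (1 + Real.pi ^ 2 / (6 * ν ^ 2)) := by positivity
  have h5 : 0 ≤ (3 * G * ν ^ 2 - Real.pi ^ 2 * C 2) * (2 * Real.pi ^ 2 * C 0) := by positivity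
  have h6 := mul_nonneg hY hg0.le
  linarith

/-- With the constants of the theorem, an amplitude above the level `T` cannot be bounded as in
`amplitude_le_of_isolated`. -/
lemma isolated_contradiction {G β β' C₂ θ L δ D T c M r₁ r₂ : ℝ} (hG : 0 < G) (hβ : 0 < β)
    (hββ' : β < β') (hC₂ : 0 < C₂) (hδ : 0 < δ) (hM : M = 4 * (C₂ + β / 4) / β)
    (hT : 2 * δ * (1 / G) * (1 + M) ≤ T) (hL : 1 / L ≤ (1 + θ) / G)
    (hθ : θ ≤ M * (1 - β / β')) (hD : 1 / G ≤ D) (hc : T < c)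
    (hmain : c ≤ 2 * δ * (1 / L) + 8 * δ / (β' * min r₁ r₂))
    (hr₁ : r₁ = 2 * D * δ / (β / (4 * G) * (c - T))) (hr₂ : r₂ = G / (C₂ + β / 4)) : False := by
  have hβ' : 0 < β' := hβ.trans hββ'
  have hM0 : 0 < M := by rw [hM]; positivity
  have hcT : 0 < c - T := by linarith
  have hD0 : 0 < D := (one_div_pos.2 hG).trans_le hD
  have hδG : 0 < 2 * δ * (1 / G) := by positivity
  have hLle : 2 * δ * (1 / L) ≤ 2 * δ * (1 / G) * (1 + θ) := by
    calc 2 * δ * (1 / L) ≤ 2 * δ * ((1 + θ) / G) := by gcongr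
      _ = _ := by ring
  have hMβ : 0 < M * (β / β') := by positivity
  rcases le_total r₁ r₂ with hcase | hcase
  · rw [min_eq_left hcase, hr₁] at hmain
    have h1 : 8 * δ / (β' * (2 * D * δ / (β / (4 * G) * (c - T))))
        = (c - T) * ((β / β') * (1 / G / D)) := by
      field_simp
      norm_num
    have h2 : β / β' ≤ 1 := (div_le_one hβ').2 hββ'.le
    have h3 : 1 / G / D ≤ 1 := (div_le_one hD0).2 hD
    have h4 : (c - T) * ((β / β') * (1 / G / D)) ≤ c - T :=
      mul_le_of_le_one_right hcT.le (mul_le_one₀ h2 (by positivity) h3)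
    have h5 : 2 * δ * (1 / G) * (1 + θ) < 2 * δ * (1 / G) * (1 + M) :=
      mul_lt_mul_of_pos_left (by linarith) hδG
    rw [h1] at hmain
    linarith
  · rw [min_eq_right hcase, hr₂] at hmain
    have h1 : 8 * δ / (β' * (G / (C₂ + β / 4))) = 2 * δ * (1 / G) * (M * (β / β')) := by
      rw [hM]
      field_simp
      norm_num
    have h2 : 2 * δ * (1 / G) * (1 + θ + M * (β / β')) ≤ 2 * δ * (1 / G) * (1 + M) :=
      mul_le_mul_of_nonneg_left (by linarith) hδG.le
    rw [h1] at hmain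
    linarith

end StreamOfPulses

open StreamOfPulses in
theorem theorem3 (g : ℝ → ℝ) (C : Fin 4 → ℝ) (ε β : ℝ)
    (hg : StreamOfPulses.IsAdmissibleKernel g C ε β) :
    ∃ ν₀ : ℝ, 0 < ν₀ ∧ ∀ ν : ℝ, ν₀ ≤ ν → ∀ N σ : ℝ, 0 < N → 0 < σ →
      ∀ (x n y : ℤ → ℝ) (δ : ℝ), 0 ≤ δ →
      StreamOfPulses.l1Norm x < ⊤ →
      StreamOfPulses.l1Norm n ≤ ENNReal.ofReal δ →
      (∀ k : ℤ, y k =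
        StreamOfPulses.conv (StreamOfPulses.sampledKernel g N σ) x k + n k) →
      StreamOfPulses.SatisfiesSeparation (Function.support x) ν N σ →
      ∀ xhat : ℤ → ℝ,
      StreamOfPulses.IsSolution (StreamOfPulses.sampledKernel g N σ) y δ xhat →
        StreamOfPulses.l1Norm (fun k => xhat k - x k)
            ≤ ENNReal.ofReal (16 * StreamOfPulses.gam N σ ε ^ 2 / β * δ) ∧
        (StreamOfPulses.epsTilde g C β ≤ ε →
          (∀ k ∈ Function.support x,
            StreamOfPulses.level g C ε β ν N σ δ ε ≤ |x k| →
            ∃ khat ∈ Function.support xhat,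
              StreamOfPulses.level g C ε β ν N σ δ (StreamOfPulses.epsTilde g C β) < |x k| →
              |(k : ℝ) - (khat : ℝ)| ≤ N * σ * Real.sqrt
                (2 * StreamOfPulses.D2 g C ε β ν N σ * δ /
                  (StreamOfPulses.D1 g β *
                    (|x k| - StreamOfPulses.level g C ε β ν N σ δ
                      (StreamOfPulses.epsTilde g C β))))) ∧
          ∑' k : {k : ℤ | k ∈ Function.support xhat ∧
              ∀ j ∈ Function.support x, N * ε * σ < |(k : ℝ) - (j : ℝ)|}, ‖xhat k‖ₑ
            ≤ ENNReal.ofReal (2 * StreamOfPulses.D2 g C ε β ν N σ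
                / (StreamOfPulses.D1 g β * ε ^ 2) * δ)) := by
  have hg0 := hg.pos
  have hβ := hg.beta_pos
  have hε := hg.eps_pos
  have hC2 := hg.const_pos 2
  obtain ⟨β', hββ', hcert⟩ := exists_certificate hg
  have hβ' : 0 < β' := hβ.trans hββ'
  set M : ℝ := 4 * (C 2 + β / 4) / β with hM
  have hM0 : 0 < M := by positivity
  have hratio : 0 < 1 - β / β' := by rw [sub_pos, div_lt_one hβ']; exact hββ'
  -- `θ` bounds the relative loss of height of the certificates
  obtain ⟨θ, hθ, hθ1, hθM, hθC⟩ : ∃ θ : ℝ, 0 < θ ∧ θ ≤ 1 ∧ θ ≤ M * (1 - β / β') ∧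
      (C 2 + β / 8) * (1 + θ) ≤ C 2 + β / 4 := by
    refine ⟨min 1 (min (M * (1 - β / β')) (β / 8 / (C 2 + β / 8))), by positivity, min_le_left _ _,
      (min_le_right _ _).trans (min_le_left _ _), ?_⟩
    have h1 := (min_le_right (1 : ℝ) (min (M * (1 - β / β')) (β / 8 / (C 2 + β / 8)))).trans
      (min_le_right _ _)
    rw [le_div_iff₀ (by positivity)] at h1
    linarith
  obtain ⟨ν₀, hν₀1, hν₀⟩ := hcert θ hθ
  obtain ⟨ν₁, hν₁⟩ := exists_forall_one_div_le_D2 hg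
  refine ⟨max ν₀ ν₁, lt_max_of_lt_left (by linarith), ?_⟩
  intro ν hν N σ hN hσ x n y δ hδ hx hn hy hsep z hz
  have hω : 0 < N * σ := mul_pos hN hσ
  have hD2 := hν₁ ν ((le_max_right _ _).trans hν) N σ
  obtain ⟨L, hLg, hLε, hL⟩ := hν₀ ν ((le_max_left _ _).trans hν) (N * σ) hω
  have hsep' : ∀ k ∈ Function.support x, ∀ j ∈ Function.support x, k ≠ j →
      ν * (N * σ) ≤ |(k : ℝ) - j| := fun k hk j hj hkj => by
    have := hsep k hk j hj hkj
    linarith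
  have hL := hL (Function.support x) hsep'
  have hL0 : 0 < L := by
    by_contra hcon
    have := mul_nonpos_of_nonneg_of_nonpos (by linarith : 0 ≤ 1 + θ) (not_lt.1 hcon)
    linarith
  obtain ⟨hxs, hzs, hzx, hpair⟩ :=
    abs_tsum_error_mul_corr_le hω hg.even hg.pulse.bound₀ hδ hx hn hy hz
  obtain ⟨f, hf⟩ := hL (fun k => if 0 ≤ z k - x k then 1 else -1) (fun i _ => by
    split_ifs <;> simp)
  have hpf := hpair f hf.abs_le_one
  have hh : Summable fun k => |z k - x k| :=
    (hzs.add hxs).of_nonneg_of_le (fun _ => abs_nonneg _) fun k => abs_sub _ _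
  obtain ⟨hgs, hgap⟩ := tsum_gapMass_le hf hβ'.le hL0.le hxs hzs hzx hpf
  -- the total error
  set γ := gam N σ ε
  have hγω : N * σ ≤ γ := le_max_left _ _
  have hγε : ε⁻¹ ≤ γ := le_max_right _ _
  have hγ0 : 0 < γ := hω.trans_le hγω
  have herr : β' / 4 / γ ^ 2 * ∑' k, |z k - x k| ≤ 4 * δ := by
    have hw : β' / 4 / γ ^ 2 ≤ β' / 4 * ε ^ 2 := by
      rw [div_eq_mul_inv]
      refine mul_le_mul_of_nonneg_left ?_ (by positivity)
      rw [← inv_pow]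
      exact pow_le_pow_left₀ (by positivity) (inv_le_of_inv_le₀ hε hγε) 2
    refine mul_tsum_abs_sub_le hf hβ'.le hxs hzs hzx hpf (by positivity) (hw.trans hLε) ?_
    intro k hk
    refine hf.gap_of_le hw fun i hi _ => ?_
    rw [div_eq_mul_inv]
    refine mul_le_mul_of_nonneg_left ?_ (by positivity)
    have h1 : (1 : ℝ) ≤ |(k : ℝ) - i| := by
      have : (1 : ℤ) ≤ |k - i| := Int.one_le_abs (sub_ne_zero.2 fun h => hk (h ▸ hi))
      exact_mod_cast this
    rw [← inv_pow, ← sq_abs (((k : ℝ) - i) / (N * σ)), abs_div, abs_of_pos hω]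
    refine pow_le_pow_left₀ (by positivity) ?_ 2
    rw [inv_eq_one_div]
    exact div_le_div₀ (abs_nonneg _) h1 hω hγω
  have herr' : ∑' k, |z k - x k| ≤ 16 * γ ^ 2 / β' * δ := by
    have h1 : (β' / 4 / γ ^ 2) * (16 * γ ^ 2 / β' * δ) = 4 * δ := by field_simp; norm_num
    have h2 : 0 < β' / 4 / γ ^ 2 := by positivity
    exact le_of_mul_le_mul_left (herr.trans_eq h1.symm) h2
  refine ⟨?_, fun hεt => ⟨?_, ?_⟩⟩
  · rw [l1Norm_eq_ofReal hh]
    refine ENNReal.ofReal_le_ofReal (herr'.trans ?_)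
    gcongr
  · intro m hm hlevel
    by_cases hzm : z m = 0
    swap
    · exact ⟨m, hzm, fun _ => by rw [sub_self, abs_zero]; positivity⟩
    -- the amplitude at a missed point is positive, which excludes the noiseless case
    have hxm : 0 < |x m| := abs_pos.2 hm
    have hδ0 : 0 < δ := by
      rcases hδ.eq_or_lt with h | h
      · exfalso
        rw [← h, mul_zero] at herr'
        have h1 := hh.le_tsum m fun k _ => abs_nonneg _
        rw [hzm, zero_sub, abs_neg] at h1
        linarith
      · exact h
    have hD20 : 0 < D2 g C ε β ν N σ := (one_div_pos.2 hg0).trans_le hD2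
    have hinvL : 1 / L ≤ (1 + θ) / g 0 := by
      rw [div_le_div_iff₀ hL0 hg0]; linarith
    -- the level at `e` dominates the part without `C₂`
    have hlev : ∀ e : ℝ, 2 * δ * (1 / g 0) * (1 + 1 / (D1 g β * e ^ 2))
        ≤ level g C ε β ν N σ δ e := by
      intro e
      have : 0 ≤ 1 / (D1 g β * e ^ 2) := by unfold D1; positivity
      unfold level
      gcongr
      exact le_max_left _ _
    by_cases hz0 : ∀ k, z k = 0
    · exfalso
      have h1 := amplitude_le_of_eq_zero hf hβ'.le hL0.le hxs hz0 hpf m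
      have h2 : 2 ≤ 1 / (D1 g β * ε ^ 2) := by
        have h3 := hg.le_sub_sq (fun t ht => (hg.concave_near t ht).le) (abs_of_pos hε).le
        have h4 := hg.pos_near ε (abs_of_pos hε).le
        unfold D1
        rw [div_mul_eq_mul_div, one_div_div, le_div_iff₀ (by positivity)]
        linarith
      have h5 : 2 * δ * (1 / g 0) * 3 ≤ |x m| := by
        refine le_trans ?_ ((hlev ε).trans hlevel)
        gcongr
        linarith
      have h6 : |x m| ≤ 2 * δ * (1 / L) := by
        rw [mul_one_div, le_div_iff₀ hL0]; linarith
      have h7 : 2 * δ * (1 / L) ≤ 2 * δ * ((1 + θ) / g 0) := by gcongr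
      have h8 : 2 * δ * ((1 + θ) / g 0) < 2 * δ * (1 / g 0) * 3 := by
        have h9 : 0 < 2 * δ * (1 / g 0) := by positivity
        have h10 : 2 * δ * ((1 + θ) / g 0) = 2 * δ * (1 / g 0) * (1 + θ) := by ring
        rw [h10]
        gcongr
        linarith
      linarith
    push Not at hz0
    set T := level g C ε β ν N σ δ (epsTilde g C β) with hT
    by_contra hcon
    push Not at hcon
    obtain ⟨k₀, hk₀⟩ := hz0
    have hTm : T < |x m| := (hcon k₀ hk₀).1
    have hD10 : 0 < D1 g β := by unfold D1; positivity
    set ρ := Real.sqrt (2 * D2 g C ε β ν N σ * δ / (D1 g β * (|x m| - T))) with hρ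
    have hq0 : 0 < 2 * D2 g C ε β ν N σ * δ / (D1 g β * (|x m| - T)) :=
      div_pos (by positivity) (mul_pos hD10 (by linarith))
    have hρ2 : ρ ^ 2 = 2 * D2 g C ε β ν N σ * δ / (D1 g β * (|x m| - T)) :=
      Real.sq_sqrt hq0.le
    have hρ0 : 0 < ρ := Real.sqrt_pos.2 hq0
    have hiso : ∀ k, z k ≠ 0 → ρ ≤ |((k : ℝ) - m) / (N * σ)| := by
      intro k hk
      have := (hcon k hk).2
      rw [abs_sub_comm] at this
      rw [abs_div, abs_of_pos hω, le_div_iff₀ hω]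
      linarith
    set e := epsTilde g C β
    have he2 : e ^ 2 = g 0 / (C 2 + β / 4) := Real.sq_sqrt (by positivity)
    have he0 : 0 < e := Real.sqrt_pos.2 (by positivity)
    have heε : e ^ 2 ≤ ε ^ 2 := pow_le_pow_left₀ he0.le hεt 2
    obtain ⟨f₁, hf₁⟩ := hL (fun _ => 1) (fun i _ => Or.inl rfl)
    obtain ⟨f₂, hf₂⟩ := hL (fun k => if k = m then 1 else -1) (fun i _ => by
      split_ifs <;> simp)
    set r := min (ρ ^ 2) (e ^ 2)
    have hr0 : 0 < r := lt_min (by positivity) (by positivity)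
    have hΓ : L / (β' / 4 * r) * (β' / 4 * r) = L := div_mul_cancel₀ _ (by positivity)
    have hΓmono : ∀ s, r ≤ s → L ≤ L / (β' / 4 * r) * (β' / 4 * s) := by
      intro s hs
      calc L = L / (β' / 4 * r) * (β' / 4 * r) := hΓ.symm
        _ ≤ _ := by gcongr
    have hmain := amplitude_le_of_isolated hf hf₁ hf₂ hβ'.le hL0.le hxs hzs hzx hpf
      (hpair f₁ hf₁.abs_le_one) (hpair f₂ hf₂.abs_le_one) hm hzm hρ0.le hiso
      (show 0 ≤ L / (β' / 4 * r) by positivity) (hΓmono _ (min_le_left _ _))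
      (hΓmono _ ((min_le_right _ _).trans heε)) (by
        have h1 : L / (β' / 4 * r) * (β' / 4) = L / r := by field_simp
        rw [h1, le_div_iff₀ hr0]
        have h2 : (2 * C 2 + β / 4) / 2 * r ≤ (C 2 + β / 8) * e ^ 2 := by
          have : (2 * C 2 + β / 4) / 2 = C 2 + β / 8 := by ring
          rw [this]
          gcongr
          exact min_le_right _ _
        refine h2.trans ?_
        rw [he2, mul_div_assoc', div_le_iff₀ (by positivity)]
        calc (C 2 + β / 8) * g 0 ≤ (C 2 + β / 8) * ((1 + θ) * L) := by gcongr
          _ = (C 2 + β / 8) * (1 + θ) * L := by ring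
          _ ≤ (C 2 + β / 4) * L := by gcongr
          _ = L * (C 2 + β / 4) := by ring)
    have hmain' : |x m| ≤ 2 * δ * (1 / L) + 8 * δ / (β' * r) := by
      have h1 : L * (2 * δ * (1 / L) + 8 * δ / (β' * r))
          = 2 * δ + L / (β' / 4 * r) * (2 * δ) := by field_simp; ring
      exact le_of_mul_le_mul_left (hmain.trans_eq h1.symm) hL0
    -- the level at `epsTilde`, with `1 / (D₁ epsTilde²) = M`
    have hTM : 2 * δ * (1 / g 0) * (1 + M) ≤ T := by
      refine le_trans (le_of_eq ?_) (hlev e)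
      rw [he2, D1, hM]
      field_simp
    exact isolated_contradiction hg0 hβ hββ' hC2 hδ0 hM hTM hinvL hθM hD2 hTm hmain' hρ2 he2
  · set w := β' / 4 * ε ^ 2 with hw
    have hw0 : 0 < w := by positivity
    have hgw : Summable fun k => gapMass g (N * σ) L x z f k / w := hgs.div_const w
    have hgw0 : ∀ k, 0 ≤ gapMass g (N * σ) L x z f k / w := fun k =>
      div_nonneg (gapMass_nonneg hf hβ'.le k) hw0.le
    calc _ ≤ ∑' k : {k : ℤ | k ∈ Function.support z ∧
              ∀ j ∈ Function.support x, N * ε * σ < |(k : ℝ) - (j : ℝ)|},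
              ENNReal.ofReal (gapMass g (N * σ) L x z f k / w) := by
          refine ENNReal.tsum_le_tsum ?_
          rintro ⟨k, -, hk⟩
          rw [Real.enorm_eq_ofReal_abs]
          refine ENNReal.ofReal_le_ofReal ?_
          have hkx : k ∉ Function.support x := fun h => by
            have := hk k h
            rw [sub_self, abs_zero] at this
            have : 0 < N * ε * σ := by positivity
            linarith
          have hgapk : w ≤ L - |corr g (N * σ) f k| := hf.gap_of_le le_rfl fun i hi hik => by
            rw [abs_div, abs_of_pos hω, div_le_iff₀ hω] at hik
            have := hk i hi
            linarith
          rw [le_div_iff₀ hw0]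
          simp only [gapMass, if_neg hkx]
          rw [mul_comm]
          gcongr
      _ ≤ ∑' k, ENNReal.ofReal (gapMass g (N * σ) L x z f k / w) :=
          ENNReal.tsum_comp_le_tsum_of_injective Subtype.val_injective _
      _ = ENNReal.ofReal (∑' k, gapMass g (N * σ) L x z f k / w) :=
          (ENNReal.ofReal_tsum_of_nonneg hgw0 hgw).symm
      _ ≤ _ := by
          refine ENNReal.ofReal_le_ofReal ?_
          rw [tsum_div_const, div_le_iff₀ hw0]
          refine hgap.trans ?_
          have h1 : 2 * D2 g C ε β ν N σ / (D1 g β * ε ^ 2) * δ * w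
              = 2 * δ * (β' / β * (g 0 * D2 g C ε β ν N σ)) := by
            rw [D1, hw]
            field_simp
          rw [h1]
          have h3 : 1 ≤ β' / β := by rw [le_div_iff₀ hβ]; linarith
          have h4 : 1 ≤ g 0 * D2 g C ε β ν N σ := by
            rw [div_le_iff₀ hg0] at hD2; linarith
          have h5 : 1 ≤ β' / β * (g 0 * D2 g C ε β ν N σ) := one_le_mul_of_one_le_of_one_le h3 h4
          nlinarith
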